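/- Let $a<b$ be real numbers, let $n,d\in\mathbb{N}$ and let $P_0,\dots,P_n\in\mathbb{R}^{d\times d}$ satisfy $P_j^\top=(-1)^{j+1}P_j$ for all $j$ and $\det P_n\neq 0$. Let $\mathcal{H}\in L_\infty(a,b;\mathbb{R}^{d\times d})$ be such that $\mathcal{H}(x)$ is symmetric for almost every $x$ and, for some $c>0$, $\langle \mathcal{H}(x)v,v\rangle\ge c\|v\|^2$ for all $v\in\mathbb{R}^d$ and almost every $x\in(a,b)$. Let $H=L_2(a,b)^d$ with the inner product $\langle u,v\rangle_H=\int_a^b\langle\mathcal{H}(x)u(x),v(x)\rangle\,dx$, and let $$A\colon \operatorname{dom}(A)\subseteq H\to H,\quad Au=\sum_{k=0}^n P_k\,\partial^k(\mathcal{H}u),\qquad \operatorname{dom}(A)=\{u\in H:\ \mathcal{H}u\in H^n(a,b)^d\},$$ where $\partial$ is the weak derivative and $H^n(a,b)$ the Sobolev space of order $n$ over $L_2$. For $w\in H^n(a,b)^d$ and $t\in[a,b]$ let $\operatorname{tr}_t w=(w(t),w'(t),\dots,w^{(n-1)}(t))\in\mathbb{R}^{nd}$, where values are those of the continuous representatives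 on $[a,b]$. Let $Q\in\mathbb{R}^{nd\times nd}$ be the symmetric block matrix whose $(i,j)$ block ($1\le i,j\le n$) is $(-1)^{i+1}P_{i+j-1}$ if $i+j-1\le n$ and $0$ otherwise. Let $E_+$ and $E_-$ be the spans of the eigenvectors of $Q$ with positive and negative eigenvalues, respectively. Let $Q_+$ be the matrix that is the positive square root of $Q|_{E_+}$ on $E_+$ and $0$ on $E_-$, and let $Q_-$ be the matrix that is the positive square root of $-Q|_{E_-}$ on $E_-$ and $0$ on $E_+$ (so that $Q=Q_+^2-Q_-^2$). Let $B\subseteq A$ be a linear restriction of $A$. Call $B$ m-accretive on $H$ if $\langle B(u)-B(v),u-v\rangle_H\ge 0$ for all $u,v\in\operatorname{dom}(B)$ and $1+B\colon \operatorname{dom}(B)\to H$ is onto. Then the following statements are equivalent: (a) $B$ is m-accretive on $H$; (b) there exists $M\in\mathbb{R}^{nd\times nd}$ with Euclidean operator norm $\|M\|\le1$ such that $$\operatorname{dom}(B)=\{u\in\operatorname{dom}(A):\ M(Q_+\operatorname{tr}_b\mathcal{H}u+Q_-\operatorname{tr}_a\mathcal{H}u)=Q_-\operatorname{tr}_b\mathcal{H}u+Q_+\operatorname{tr}_a\mathcal{H}u\};$$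 (c) there exists $W\in\mathbb{R}^{nd\times 2nd}$ of rank $nd$ with $$W\begin{pmatrix}-Q&Q\\1&1\end{pmatrix}^{-1}\begin{pmatrix}0&1\\1&0\end{pmatrix}\left(W\begin{pmatrix}-Q&Q\\1&1\end{pmatrix}^{-1}\right)^{*}\ge0$$ such that $$\operatorname{dom}(B)=\left\{u\in\operatorname{dom}(A):\ W\begin{pmatrix}\operatorname{tr}_b\mathcal{H}u\\\operatorname{tr}_a\mathcal{H}u\end{pmatrix}=0\right\}.$$ -/

import Mathlib

open MeasureTheory Set
open scoped ContDiff ENNReal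

noncomputable section

namespace PortHamiltonian

/-! ### m-accretive operators -/

/-- A linear operator `B : dom(B) ⊆ E → E` is m-accretive with respect to the inner product `ip` on
the real vector space `E` if `ip (B u - B v) (u - v) ≥ 0` for all `u, v ∈ dom(B)` and `1 + B` is
onto. -/
def IsMAccretive {E : Type*} [AddCommGroup E] [Module ℝ E] (ip : E → E → ℝ) (B : E →ₗ.[ℝ] E) :
    Prop :=
  (∀ u v : B.domain, 0 ≤ ip (B u - B v) ((u : E) - (v : E))) ∧
    ∀ f : E, ∃ u : B.domain, (u : E) + B u = f

/-! ### The space `L₂(a,b)^d`, weak derivatives and Sobolev spaces -/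

/-- Lebesgue measure on the interval `(a,b)`. -/
abbrev μ (a b : ℝ) : Measure ℝ := volume.restrict (Ioo a b)

/-- The space `L₂(a,b)^d`. -/
abbrev L2 (a b : ℝ) (d : ℕ) : Type := Lp (EuclideanSpace ℝ (Fin d)) 2 (μ a b)

/-- `v` is the weak derivative of `u` on `(a,b)`: for every test function `φ ∈ C_c^∞(a,b)` one has
`∫ φ' u = - ∫ φ v`. -/
def IsWeakDeriv {a b : ℝ} {d : ℕ} (u v : L2 a b d) : Prop :=
  ∀ φ : ℝ → ℝ, ContDiff ℝ ∞ φ → HasCompactSupport φ → tsupport φ ⊆ Ioo a b →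
    ∫ x, deriv φ x • u x ∂(μ a b) = -∫ x, φ x • v x ∂(μ a b)

theorem integrable_smul {a b : ℝ} {d : ℕ} (u : L2 a b d) {φ : ℝ → ℝ} (hφ : Continuous φ)
    (hc : HasCompactSupport φ) : Integrable (fun x => φ x • u x) (μ a b) := by
  have hu : Integrable u (μ a b) := (Lp.memLp u).integrable (by norm_num)
  obtain ⟨C, hC⟩ := hc.exists_bound_of_continuous hφ
  exact hu.bdd_smul C hφ.aestronglyMeasurable (Filter.Eventually.of_forall hC)

theorem isWeakDeriv_zero {a b : ℝ} {d : ℕ} : IsWeakDeriv (0 : L2 a b d) 0 := by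
  intro φ _ _ _
  have h : ((0 : L2 a b d) : ℝ → _) =ᵐ[μ a b] 0 := Lp.coeFn_zero _ _ _
  rw [integral_eq_zero_of_ae, integral_eq_zero_of_ae, neg_zero]
  · filter_upwards [h] with x hx
    rw [hx, Pi.zero_apply, smul_zero]
  · filter_upwards [h] with x hx
    rw [hx, Pi.zero_apply, smul_zero]

theorem IsWeakDeriv.add {a b : ℝ} {d : ℕ} {u v u' v' : L2 a b d} (h : IsWeakDeriv u v)
    (h' : IsWeakDeriv u' v') : IsWeakDeriv (u + u') (v + v') := by
  intro φ hφ hc hs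
  have key : ∀ (w w' : L2 a b d) (ψ : ℝ → ℝ), Continuous ψ → HasCompactSupport ψ →
      ∫ x, ψ x • (w + w' : L2 a b d) x ∂(μ a b)
        = ∫ x, ψ x • w x ∂(μ a b) + ∫ x, ψ x • w' x ∂(μ a b) := by
    intro w w' ψ h1 h2
    rw [← integral_add (integrable_smul w h1 h2) (integrable_smul w' h1 h2)]
    refine integral_congr_ae ?_
    filter_upwards [Lp.coeFn_add w w'] with x hx
    rw [hx, Pi.add_apply, smul_add]
  rw [key _ _ _ (hφ.continuous_deriv (by simp)) hc.deriv, key _ _ _ hφ.continuous hc,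
    h φ hφ hc hs, h' φ hφ hc hs, neg_add]

theorem IsWeakDeriv.smul {a b : ℝ} {d : ℕ} {u v : L2 a b d} (r : ℝ) (h : IsWeakDeriv u v) :
    IsWeakDeriv (r • u) (r • v) := by
  intro φ hφ hc hs
  have key : ∀ (w : L2 a b d) (ψ : ℝ → ℝ),
      ∫ x, ψ x • (r • w : L2 a b d) x ∂(μ a b) = r • ∫ x, ψ x • w x ∂(μ a b) := by
    intro w ψ
    rw [← integral_smul]
    refine integral_congr_ae ?_
    filter_upwards [Lp.coeFn_smul r w] with x hx
    rw [hx, Pi.smul_apply, smul_comm]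
  rw [key, key, h φ hφ hc hs, smul_neg]

/-- A weak derivative is unique. -/
theorem IsWeakDeriv.unique {a b : ℝ} {d : ℕ} {u v w : L2 a b d} (hv : IsWeakDeriv u v)
    (hw : IsWeakDeriv u w) : v = w := by
  have h0 : IsWeakDeriv (0 : L2 a b d) (v - w) := by
    have := hv.add (hw.smul (-1))
    simpa [sub_eq_add_neg] using this
  have hz : ((0 : L2 a b d) : ℝ → _) =ᵐ[μ a b] 0 := Lp.coeFn_zero _ _ _
  have hint : Integrable (v - w : L2 a b d) (μ a b) := (Lp.memLp _).integrable (by norm_num)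
  have hae := isOpen_Ioo.ae_eq_zero_of_integral_contDiff_smul_eq_zero (U := Ioo a b) (μ := volume)
    (f := (v - w : L2 a b d)) (IntegrableOn.locallyIntegrableOn hint) (by
      intro g hg hc hs
      have h1 := h0 g hg hc hs
      rw [integral_eq_zero_of_ae (by filter_upwards [hz] with x hx; rw [hx, Pi.zero_apply, smul_zero])] at h1
      have h2 : ∫ x in Ioo a b, g x • (v - w : L2 a b d) x = 0 := neg_eq_zero.mp h1.symm
      rw [← h2, setIntegral_eq_integral_of_forall_compl_eq_zero]
      intro x hx
      rw [image_eq_zero_of_notMem_tsupport (fun h => hx (hs h)), zero_smul])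
  have h3 : v - w = 0 := by
    rw [Lp.eq_zero_iff_ae_eq_zero]
    exact (ae_restrict_iff' measurableSet_Ioo).2 hae
  exact sub_eq_zero.1 h3

/-- The tuples `(u, u', …, u^{(n)})` of elements of `L₂(a,b)^d` in which each entry is the weak
derivative of the previous one. -/
def jets (a b : ℝ) (d n : ℕ) : Submodule ℝ (Fin (n + 1) → L2 a b d) where
  carrier := {w | ∀ k : Fin n, IsWeakDeriv (w k.castSucc) (w k.succ)}
  zero_mem' := fun _ => isWeakDeriv_zero
  add_mem' := fun h h' k => (h k).add (h' k)
  smul_mem' := fun r _ h k => (h k).smul r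

/-- The map `(u, u', …, u^{(n)}) ↦ u`. -/
def jetsFst (a b : ℝ) (d n : ℕ) : jets a b d n →ₗ[ℝ] L2 a b d :=
  (LinearMap.proj 0).comp (jets a b d n).subtype

theorem jetsFst_injective (a b : ℝ) (d n : ℕ) : Function.Injective (jetsFst a b d n) := by
  intro w w' h
  have h0 : w.1 0 = w'.1 0 := h
  refine Subtype.ext (funext fun k => ?_)
  induction k using Fin.induction with
  | zero => exact h0
  | succ k ih => exact (w.2 k).unique (by rw [ih]; exact w'.2 k)

/-- The Sobolev space `Hⁿ(a,b)^d`: the elements of `L₂(a,b)^d` whose weak derivatives up to order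
`n` exist in `L₂(a,b)^d`. -/
def sobolev (a b : ℝ) (d n : ℕ) : Submodule ℝ (L2 a b d) := LinearMap.range (jetsFst a b d n)

/-- For `u ∈ Hⁿ(a,b)^d` the tuple `(u, u', …, u^{(n)})` of its weak derivatives. -/
def jet (a b : ℝ) (d n : ℕ) : sobolev a b d n →ₗ[ℝ] (Fin (n + 1) → L2 a b d) :=
  (jets a b d n).subtype.comp
    (LinearEquiv.ofInjective (jetsFst a b d n) (jetsFst_injective a b d n)).symm.toLinearMap

theorem jet_zero {a b : ℝ} {d n : ℕ} (u : sobolev a b d n) : jet a b d n u 0 = u :=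
  congrArg Subtype.val
    ((LinearEquiv.ofInjective (jetsFst a b d n) (jetsFst_injective a b d n)).apply_symm_apply u)

theorem jet_succ {a b : ℝ} {d n : ℕ} (u : sobolev a b d n) (k : Fin n) :
    IsWeakDeriv (jet a b d n u k.castSucc) (jet a b d n u k.succ) :=
  ((LinearEquiv.ofInjective (jetsFst a b d n) (jetsFst_injective a b d n)).symm u).2 k

/-! ### Boundary traces -/

open Classical in
/-- The value at `t ∈ [a,b]` of the continuous representative on `[a,b]` of an element of
`L₂(a,b)^d` that has one (as every element of `H¹(a,b)^d` does); zero if there is none. -/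
def contValue {a b : ℝ} {d : ℕ} (v : L2 a b d) (t : ℝ) : EuclideanSpace ℝ (Fin d) :=
  if h : ∃ f : ℝ → EuclideanSpace ℝ (Fin d), ContinuousOn f (Icc a b) ∧ v =ᵐ[μ a b] f then
    h.choose t
  else 0

/-- The continuous representative is unique, so its values do not depend on a choice. -/
theorem contValue_eq {a b : ℝ} (hab : a < b) {d : ℕ} {v : L2 a b d}
    {f : ℝ → EuclideanSpace ℝ (Fin d)} (hf : ContinuousOn f (Icc a b)) (hv : v =ᵐ[μ a b] f)
    {t : ℝ} (ht : t ∈ Icc a b) : contValue v t = f t := by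
  have h : ∃ f : ℝ → EuclideanSpace ℝ (Fin d), ContinuousOn f (Icc a b) ∧ v =ᵐ[μ a b] f :=
    ⟨f, hf, hv⟩
  have hae : h.choose =ᵐ[μ a b] f := h.choose_spec.2.symm.trans hv
  have hIcc : h.choose =ᵐ[volume.restrict (Icc a b)] f := by
    rw [← Measure.restrict_congr_set (μ := volume) (Ioo_ae_eq_Icc (a := a) (b := b))]
    exact hae
  rw [contValue, dif_pos h]
  exact Measure.eqOn_Icc_of_ae_eq volume hab.ne hIcc h.choose_spec.1 hf ht

/-- The trace `tr_t u = (u(t), u'(t), …, u^{(n-1)}(t)) ∈ ℝ^{nd}` of `u ∈ Hⁿ(a,b)^d`. -/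
def trace {a b : ℝ} {d n : ℕ} (t : ℝ) (u : sobolev a b d n) : Fin n × Fin d → ℝ :=
  fun p => contValue (jet a b d n u p.1.castSucc) t p.2

/-! ### The matrices `Q`, `Q₊`, `Q₋` -/

/-- The block matrix `Q ∈ ℝ^{nd × nd}`. Its `(i,j)` block, `i, j = 1, …, n`, is
`(-1)^{i+1} P_{i+j-1}` if `i + j - 1 ≤ n` and zero otherwise (below, indices start at zero). -/
def Q {d n : ℕ} (P : Fin (n + 1) → Matrix (Fin d) (Fin d) ℝ) :
    Matrix (Fin n × Fin d) (Fin n × Fin d) ℝ :=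
  Matrix.of fun p q =>
    if h : (p.1 : ℕ) + q.1 + 1 < n + 1 then
      (-1) ^ (p.1 : ℕ) * P ⟨(p.1 : ℕ) + q.1 + 1, h⟩ p.2 q.2
    else 0

/-- `Q` is symmetric, so that the functional calculus below is the genuine one. -/
theorem Q_isHermitian {d n : ℕ} {P : Fin (n + 1) → Matrix (Fin d) (Fin d) ℝ}
    (hP : ∀ j : Fin (n + 1), (P j).transpose = (-1 : ℝ) ^ ((j : ℕ) + 1) • P j) :
    (Q P).IsHermitian := by
  ext p q
  rw [Matrix.conjTranspose_apply, star_trivial, Q, Matrix.of_apply, Matrix.of_apply]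
  by_cases h : (p.1 : ℕ) + q.1 + 1 < n + 1
  · have h' : (q.1 : ℕ) + p.1 + 1 < n + 1 := by omega
    rw [dif_pos h, dif_pos h']
    have e : (⟨(q.1 : ℕ) + p.1 + 1, h'⟩ : Fin (n + 1)) = ⟨(p.1 : ℕ) + q.1 + 1, h⟩ :=
      Fin.ext (by simp only; omega)
    have h1 := congrFun (congrFun (hP ⟨(p.1 : ℕ) + q.1 + 1, h⟩) p.2) q.2
    rw [Matrix.transpose_apply, Matrix.smul_apply, smul_eq_mul] at h1
    rw [e, h1, ← mul_assoc]
    congr 1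
    rw [← pow_add, show (q.1 : ℕ) + ((p.1 : ℕ) + q.1 + 1 + 1) = p.1 + 2 * (q.1 + 1) by ring,
      pow_add, pow_mul, neg_one_sq, one_pow, mul_one]
  · rw [dif_neg h, dif_neg (by omega)]

/-- A function `f` of a symmetric matrix acts on an eigenvector for the eigenvalue `l` as
multiplication by `f l`. -/
theorem cfc_mulVec {ι : Type*} [Fintype ι] [DecidableEq ι] {A : Matrix ι ι ℝ}
    (hA : A.IsHermitian) (f : ℝ → ℝ) {x : ι → ℝ} {l : ℝ} (hx : A.mulVec x = l • x) :
    (cfc f A).mulVec x = f l • x := by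
  have hs := hA.spectral_theorem
  set U : Matrix ι ι ℝ := (hA.eigenvectorUnitary : Matrix ι ι ℝ) with hU
  have hUU : star U * U = 1 := Unitary.star_mul_self_of_mem hA.eigenvectorUnitary.2
  have hUU' : U * star U = 1 := Unitary.mul_star_self_of_mem hA.eigenvectorUnitary.2
  rw [Unitary.conjStarAlgAut_apply] at hs
  have hc : cfc f A = U * Matrix.diagonal (fun i => f (hA.eigenvalues i)) * star U := by
    rw [hA.cfc_eq, Matrix.IsHermitian.cfc, Unitary.conjStarAlgAut_apply]
    rfl
  have hs' : A = U * Matrix.diagonal (fun i => hA.eigenvalues i) * star U := hs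
  set y := (star U).mulVec x with hy
  have h1 : (Matrix.diagonal (fun i => hA.eigenvalues i)).mulVec y = l • y := by
    have h2 : (star U).mulVec (A.mulVec x) = l • y := by rw [hx, Matrix.mulVec_smul]
    rw [← h2, hy, Matrix.mulVec_mulVec, Matrix.mulVec_mulVec]
    conv_rhs => rw [hs']
    rw [← mul_assoc, ← mul_assoc, hUU, one_mul]
  have h3 : (Matrix.diagonal (fun i => f (hA.eigenvalues i))).mulVec y = f l • y := by
    funext i
    have h4 := congrFun h1 i
    rw [Matrix.mulVec_diagonal, Pi.smul_apply, smul_eq_mul] at h4 ⊢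
    rcases eq_or_ne (y i) 0 with h0 | h0
    · rw [h0, mul_zero, mul_zero]
    · rw [mul_right_cancel₀ h0 h4]
  rw [hc, ← Matrix.mulVec_mulVec, ← Matrix.mulVec_mulVec, ← hy, h3, Matrix.mulVec_smul, hy,
    Matrix.mulVec_mulVec, hUU', Matrix.one_mulVec]

/-- `Q₊`: the square root of `Q` on the span `E₊` of the eigenvectors of `Q` with positive
eigenvalue, extended by zero on the span `E₋` of those with negative eigenvalue. -/
def Qplus {d n : ℕ} (P : Fin (n + 1) → Matrix (Fin d) (Fin d) ℝ) :
    Matrix (Fin n × Fin d) (Fin n × Fin d) ℝ :=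
  cfc (fun l : ℝ => √(max l 0)) (Q P)

/-- `Q₋`: the square root of `-Q` on the span `E₋` of the eigenvectors of `Q` with negative
eigenvalue, extended by zero on the span `E₊` of those with positive eigenvalue. -/
def Qminus {d n : ℕ} (P : Fin (n + 1) → Matrix (Fin d) (Fin d) ℝ) :
    Matrix (Fin n × Fin d) (Fin n × Fin d) ℝ :=
  cfc (fun l : ℝ => √(max (-l) 0)) (Q P)

/-- The block matrix with rows `(-Q, Q)` and `(1, 1)`. -/
def blockR {d n : ℕ} (P : Fin (n + 1) → Matrix (Fin d) (Fin d) ℝ) :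
    Matrix ((Fin n × Fin d) ⊕ (Fin n × Fin d)) ((Fin n × Fin d) ⊕ (Fin n × Fin d)) ℝ :=
  Matrix.fromBlocks (-Q P) (Q P) 1 1

/-- The block matrix with rows `(0, 1)` and `(1, 0)`. -/
def blockSwap (d n : ℕ) :
    Matrix ((Fin n × Fin d) ⊕ (Fin n × Fin d)) ((Fin n × Fin d) ⊕ (Fin n × Fin d)) ℝ :=
  Matrix.fromBlocks 0 1 1 0

/-! ### The port-Hamiltonian operator -/

theorem memLp_mul {a b : ℝ} {d : ℕ} {𝓗 : ℝ → Matrix (Fin d) (Fin d) ℝ}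
    (h𝓗 : ∀ i j, MemLp (fun x => 𝓗 x i j) ∞ (μ a b)) (u : L2 a b d) :
    MemLp (fun x => Matrix.toEuclideanLin (𝓗 x) (u x)) 2 (μ a b) := by
  refine MemLp.of_eval_piLp fun i => ?_
  have h : ∀ j, MemLp (fun x => 𝓗 x i j * u x j) 2 (μ a b) := fun j =>
    ((Lp.memLp u).eval_piLp j).mul' (h𝓗 i j)
  exact memLp_finsetSum Finset.univ fun j _ => h j

/-- Multiplication `u ↦ 𝓗 u` on `L₂(a,b)^d` by a matrix function `𝓗 ∈ L_∞(a,b; ℝ^{d×d})`. -/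
def mulL2 {a b : ℝ} {d : ℕ} (𝓗 : ℝ → Matrix (Fin d) (Fin d) ℝ)
    (h𝓗 : ∀ i j, MemLp (fun x => 𝓗 x i j) ∞ (μ a b)) : L2 a b d →ₗ[ℝ] L2 a b d where
  toFun u := (memLp_mul h𝓗 u).toLp
  map_add' u v := by
    rw [← MemLp.toLp_add, MemLp.toLp_eq_toLp_iff]
    filter_upwards [Lp.coeFn_add u v] with x hx
    simp only [hx, Pi.add_apply, map_add]
  map_smul' r u := by
    rw [RingHom.id_apply, ← MemLp.toLp_const_smul, MemLp.toLp_eq_toLp_iff]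
    filter_upwards [Lp.coeFn_smul r u] with x hx
    simp only [hx, Pi.smul_apply, map_smul]

/-- The inner product `⟨u, v⟩_H = ∫_a^b ⟨𝓗(x) u(x), v(x)⟩ dx` of the space `H`, which is
`L₂(a,b)^d` as a vector space. -/
def weightedInner {a b : ℝ} {d : ℕ} (𝓗 : ℝ → Matrix (Fin d) (Fin d) ℝ) (u v : L2 a b d) : ℝ :=
  ∫ x, inner ℝ (Matrix.toEuclideanLin (𝓗 x) (u x)) (v x) ∂(μ a b)

/-- The port-Hamiltonian operator `A u = ∑_{k=0}^n P_k ∂^k (𝓗 u)` with domain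
`{u ∈ H ; 𝓗 u ∈ Hⁿ(a,b)^d}`. -/
def portHamiltonian {a b : ℝ} {d n : ℕ} (P : Fin (n + 1) → Matrix (Fin d) (Fin d) ℝ)
    (𝓗 : ℝ → Matrix (Fin d) (Fin d) ℝ) (h𝓗 : ∀ i j, MemLp (fun x => 𝓗 x i j) ∞ (μ a b)) :
    L2 a b d →ₗ.[ℝ] L2 a b d where
  domain := (sobolev a b d n).comap (mulL2 𝓗 h𝓗)
  toFun := ∑ k : Fin (n + 1),
    ((Matrix.toEuclideanCLM (𝕜 := ℝ) (P k)).compLpL 2 (μ a b)).toLinearMap ∘ₗ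
      LinearMap.proj k ∘ₗ jet a b d n ∘ₗ (mulL2 𝓗 h𝓗).restrict (fun _ hu => hu)

end PortHamiltonian

end

/-!
# m-accretive restrictions of port-Hamiltonian operators

For `u ∈ dom(A)` put `w = 𝓗 u`, `y = tr_b w`, `z = tr_a w`. The differential expression `∑ P_k
∂^k` is formally skew-symmetric, so integrating by parts leaves only boundary terms, `2 ⟨A u, u⟩_H
= ⟨Q y, y⟩ - ⟨Q z, z⟩` (`two_mul_inner_sum_matMul`). In the coordinates `F = Q₊ y + Q₋ z`, `G = Q₋
y + Q₊ z` the right-hand side is `|F|² - |G|²` (`IsRootPair.dotProduct_sub_dotProduct`), so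
accretivity of a restriction means `|G| ≤ |F|` on it, and the boundary condition `M F = G` with a
contraction `M` is accretive.

If `B` is m-accretive, then `G = M F` on `dom(B)` for a contraction `M`
(`exists_contraction_mulVec_eq`); the restriction of `A` to `{M F = G}` is accretive and extends
`B`, and since `1 + B` is already onto, the two agree. Surjectivity of the trace map is not needed
here.

Conversely let `M` be a contraction. The equation `u + A u = f` can be solved with any prescribed
value of `tr_a 𝓗 u` (`exists_add_portHamiltonian_eq`): for `w` it is a linear initial value
problem of order `n`, whose Volterra operator becomes a contraction in a norm with a sufficiently
strong exponential weight; for `n = 0` it is solved by coercivity. Hence `1 + A` is onto and `dim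
ker (1 + A) ≥ n d`. By accretivity `M F - G` is injective on `ker (1 + A)`, hence bijective onto
`ℝ^{nd}`, so any solution of `u + A u = f` can be corrected to one with `M F = G`
(`exists_add_eq_boundary`).

The equivalence of the two descriptions of the boundary condition is linear algebra in `ℝ^{nd}`.
In the coordinates `(F, G)` a kernel is given by `X F + Y G = 0`, and the sign condition on `W`
reads `Y Yᵀ - X Xᵀ ≥ 0` (`IsRootPair.kernel_form_eq`). Together with full rank this makes `Y`
invertible and `M = -Y⁻¹ X` a contraction; the converse is the choice `X = M`, `Y = -1`.
-/

noncomputable section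

namespace PortHamiltonian

/-! ### Primitives, test functions and the du Bois-Reymond lemma -/

/-- Integration by parts for primitives of integrable functions. -/
theorem integral_mul_primitive_add_primitive_mul {a b : ℝ} (hab : a ≤ b) {f g : ℝ → ℝ}
    (hf : IntegrableOn f (Ioo a b)) (hg : IntegrableOn g (Ioo a b)) (c c' : ℝ) :
    ∫ x in Ioo a b, f x * (c' + ∫ t in a..x, g t) + (c + ∫ t in a..x, f t) * g x
      = (c + ∫ t in a..b, f t) * (c' + ∫ t in a..b, g t) - c * c' := by
  have hf' : IntervalIntegrable f volume a b :=
    (intervalIntegrable_iff_integrableOn_Ioo_of_le hab).2 hf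
  have hg' : IntervalIntegrable g volume a b :=
    (intervalIntegrable_iff_integrableOn_Ioo_of_le hab).2 hg
  have hF := hf'.absolutelyContinuousOnInterval_intervalIntegral (c := a) left_mem_uIcc
  have hG := hg'.absolutelyContinuousOnInterval_intervalIntegral (c := a) left_mem_uIcc
  have hc : ∀ r : ℝ, AbsolutelyContinuousOnInterval (fun _ : ℝ => r) a b := fun r =>
    (contDiff_const (n := 1)).contDiffOn.absolutelyContinuousOnInterval
  have key := ((hc c).add hF).integral_deriv_mul_eq_sub ((hc c').add hG)
  simp only [Pi.add_apply, intervalIntegral.integral_same, add_zero] at key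
  rw [← key, intervalIntegral.integral_of_le hab, integral_Ioc_eq_integral_Ioo]
  refine setIntegral_congr_ae measurableSet_Ioo ?_
  filter_upwards [hf'.ae_hasDerivAt_integral, hg'.ae_hasDerivAt_integral] with x h1 h2 hx
  have hx' : x ∈ uIcc a b := by rw [uIcc_of_le hab]; exact Ioo_subset_Icc_self hx
  have d1 := ((h1 hx' a left_mem_uIcc).const_add c).deriv
  have d2 := ((h2 hx' a left_mem_uIcc).const_add c').deriv
  have e1 : deriv ((fun _ : ℝ => c) + fun x => ∫ t in a..x, f t) x = f x := d1
  have e2 : deriv ((fun _ : ℝ => c') + fun x => ∫ t in a..x, g t) x = g x := d2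
  rw [e1, e2]

theorem exists_Icc_subset_Ioo {a b : ℝ} (hab : a < b) {K : Set ℝ} (hK : IsCompact K)
    (h : K ⊆ Ioo a b) : ∃ c d, a < c ∧ c ≤ d ∧ d < b ∧ K ⊆ Icc c d := by
  rcases K.eq_empty_or_nonempty with rfl | hne
  · exact ⟨(a + b) / 2, (a + b) / 2, by linarith, le_rfl, by linarith, empty_subset _⟩
  · have h1 := hK.sInf_mem hne
    have h2 := hK.sSup_mem hne
    exact ⟨sInf K, sSup K, (h h1).1, csInf_le hK.bddBelow h2, (h h2).2,
      fun x hx => ⟨csInf_le hK.bddBelow hx, le_csSup hK.bddAbove hx⟩⟩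

/-- A test function with vanishing integral is the derivative of a test function. -/
theorem exists_deriv_eq_of_integral_eq_zero {a b : ℝ} (hab : a < b) {φ : ℝ → ℝ}
    (hφ : ContDiff ℝ ∞ φ) (hc : HasCompactSupport φ) (hs : tsupport φ ⊆ Ioo a b)
    (h0 : ∫ x in a..b, φ x = 0) :
    ∃ θ : ℝ → ℝ, ContDiff ℝ ∞ θ ∧ HasCompactSupport θ ∧ tsupport θ ⊆ Ioo a b ∧ deriv θ = φ := by
  obtain ⟨c, d, hac, hcd, hdb, hK⟩ := exists_Icc_subset_Ioo hab hc hs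
  have hzero : ∀ x, x ∉ Icc c d → φ x = 0 := fun x hx =>
    image_eq_zero_of_notMem_tsupport fun h => hx (hK h)
  have hd : ∀ x, HasDerivAt (fun x => ∫ t in a..x, φ t) (φ x) x := fun x =>
    intervalIntegral.integral_hasDerivAt_right (hφ.continuous.intervalIntegrable _ _)
      (hφ.continuous.stronglyMeasurableAtFilter _ _) hφ.continuous.continuousAt
  have hderiv : deriv (fun x => ∫ t in a..x, φ t) = φ := funext fun x => (hd x).deriv
  have hsub : tsupport (fun x => ∫ t in a..x, φ t) ⊆ Icc c d := by
    refine closure_minimal (fun x hx => ?_) isClosed_Icc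
    by_contra hx'
    refine hx ?_
    rcases lt_or_ge x c with h | h
    · show ∫ t in a..x, φ t = 0
      refine (intervalIntegral.integral_congr (g := fun _ => (0 : ℝ)) fun t ht => hzero t ?_).trans
        (by simp)
      intro ht'
      have := ht.2.trans (max_le hac.le h.le)
      have hm : max a x < c := max_lt hac h
      linarith [ht.2, ht'.1]
    · have hxd : d < x := by
        by_contra h'
        exact hx' ⟨h, not_lt.1 h'⟩
      show ∫ t in a..x, φ t = 0
      rw [← intervalIntegral.integral_add_adjacent_intervals
        (hφ.continuous.intervalIntegrable a b) (hφ.continuous.intervalIntegrable b x), h0, zero_add]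
      refine (intervalIntegral.integral_congr (g := fun _ => (0 : ℝ)) fun t ht => hzero t ?_).trans
        (by simp)
      intro ht'
      have hm : d < min b x := lt_min hdb hxd
      linarith [ht.1, ht'.2]
  refine ⟨fun x => ∫ t in a..x, φ t, ?_, ?_, ?_, hderiv⟩
  · rw [contDiff_infty_iff_deriv, hderiv]
    exact ⟨fun x => (hd x).differentiableAt, hφ⟩
  · exact isCompact_Icc.of_isClosed_subset (isClosed_tsupport _) hsub
  · exact hsub.trans fun x hx => ⟨hac.trans_le hx.1, hx.2.trans_lt hdb⟩

/-- There is a test function on `(a,b)` with integral one. -/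
theorem exists_testFunction_integral_eq_one {a b : ℝ} (hab : a < b) :
    ∃ ψ : ℝ → ℝ, ContDiff ℝ ∞ ψ ∧ HasCompactSupport ψ ∧ tsupport ψ ⊆ Ioo a b ∧
      ∫ x in a..b, ψ x = 1 := by
  have hr : 0 < (b - a) / 4 := by linarith
  let B : ContDiffBump ((a + b) / 2) := ⟨(b - a) / 4, (b - a) / 3, hr, by linarith⟩
  have hsub : tsupport (B.normed volume) ⊆ Ioo a b := by
    rw [B.tsupport_normed_eq]
    intro x hx
    rw [Metric.mem_closedBall, Real.dist_eq, abs_le] at hx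
    have h1 : -((b - a) / 3) ≤ x - (a + b) / 2 := hx.1
    have h2 : x - (a + b) / 2 ≤ (b - a) / 3 := hx.2
    constructor <;> linarith
  refine ⟨B.normed volume, B.contDiff_normed, B.hasCompactSupport_normed, hsub, ?_⟩
  rw [intervalIntegral.integral_of_le hab.le, setIntegral_eq_integral_of_forall_compl_eq_zero,
    B.integral_normed]
  intro x hx
  exact image_eq_zero_of_notMem_tsupport fun h => hx (Ioo_subset_Ioc_self (hsub h))

theorem integral_restrict_Ioo_eq {a b : ℝ} (hab : a ≤ b) (φ : ℝ → ℝ) :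
    ∫ x, φ x ∂(μ a b) = ∫ x in a..b, φ x := by
  rw [intervalIntegral.integral_of_le hab, integral_Ioc_eq_integral_Ioo]

/-- The du Bois-Reymond lemma: a function with vanishing weak derivative is constant. -/
theorem exists_ae_eq_const {a b : ℝ} (hab : a < b) {E : Type*} [NormedAddCommGroup E]
    [NormedSpace ℝ E] [CompleteSpace E] {u : ℝ → E} (hu : Integrable u (μ a b))
    (h : ∀ φ : ℝ → ℝ, ContDiff ℝ ∞ φ → HasCompactSupport φ → tsupport φ ⊆ Ioo a b →
      ∫ x, deriv φ x • u x ∂(μ a b) = 0) :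
    ∃ c : E, u =ᵐ[μ a b] fun _ => c := by
  obtain ⟨ψ, hψ, hψc, hψs, hψ1⟩ := exists_testFunction_integral_eq_one hab
  have hsm : ∀ {v : ℝ → E}, Integrable v (μ a b) → ∀ {φ : ℝ → ℝ}, Continuous φ →
      HasCompactSupport φ → Integrable (fun x => φ x • v x) (μ a b) := by
    intro v hv φ hφ hc
    obtain ⟨C, hC⟩ := hc.exists_bound_of_continuous hφ
    exact hv.bdd_smul C hφ.aestronglyMeasurable (Filter.Eventually.of_forall hC)
  set c : E := ∫ x, ψ x • u x ∂(μ a b) with hcdef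
  refine ⟨c, ?_⟩
  have hint : Integrable (fun x => u x - c) (μ a b) := hu.sub (integrable_const c)
  have hae := isOpen_Ioo.ae_eq_zero_of_integral_contDiff_smul_eq_zero (U := Ioo a b) (μ := volume)
    (f := fun x => u x - c) (IntegrableOn.locallyIntegrableOn hint) (by
      intro g hg hgc hgs
      -- `g - I ψ` has vanishing integral, so it is the derivative of a test function.
      set I : ℝ := ∫ x in a..b, g x with hI
      have hφ : ContDiff ℝ ∞ (fun x => g x - I * ψ x) := hg.sub (contDiff_const.mul hψ)
      have hts : tsupport (fun x => g x - I * ψ x) ⊆ tsupport g ∪ tsupport ψ := by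
        refine closure_minimal (fun x hx => ?_) ((isClosed_tsupport _).union (isClosed_tsupport _))
        by_contra h'
        rw [mem_union, not_or] at h'
        refine hx ?_
        simp [image_eq_zero_of_notMem_tsupport h'.1, image_eq_zero_of_notMem_tsupport h'.2]
      have hφc : HasCompactSupport (fun x => g x - I * ψ x) :=
        (hgc.isCompact.union hψc.isCompact).of_isClosed_subset (isClosed_tsupport _) hts
      have hφ0 : ∫ x in a..b, (g x - I * ψ x) = 0 := by
        have hi : IntervalIntegrable (fun x => I * ψ x) volume a b :=
          (continuous_const.mul hψ.continuous).intervalIntegrable _ _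
        rw [intervalIntegral.integral_sub (hg.continuous.intervalIntegrable _ _) hi,
          intervalIntegral.integral_const_mul, hψ1, mul_one, hI, sub_self]
      obtain ⟨θ, hθ, hθc, hθs, hθd⟩ := exists_deriv_eq_of_integral_eq_zero hab hφ hφc
        (hts.trans (union_subset hgs hψs)) hφ0
      have h1 := h θ hθ hθc hθs
      rw [hθd] at h1
      have h2 : ∫ x, g x • (u x - c) ∂(μ a b) = 0 := by
        calc ∫ x, g x • (u x - c) ∂(μ a b)
            = ∫ x, g x • u x ∂(μ a b) - ∫ x, g x • c ∂(μ a b) := by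
              rw [← integral_sub (hsm hu hg.continuous hgc)
                (hsm (integrable_const c) hg.continuous hgc)]
              simp only [smul_sub]
          _ = ∫ x, g x • u x ∂(μ a b) - I • c := by
              rw [integral_smul_const, integral_restrict_Ioo_eq hab.le]
          _ = ∫ x, (g x - I * ψ x) • u x ∂(μ a b) := by
              have hi : Integrable (fun x => I • ψ x • u x) (μ a b) :=
                (hsm hu hψ.continuous hψc).smul I
              simp only [sub_smul, mul_smul]
              rw [integral_sub (hsm hu hg.continuous hgc) hi, integral_smul]
          _ = 0 := h1
      rw [← h2]
      refine (setIntegral_eq_integral_of_forall_compl_eq_zero fun x hx => ?_).symm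
      rw [image_eq_zero_of_notMem_tsupport (fun h => hx (hgs h)), zero_smul])
  have := (ae_restrict_iff' measurableSet_Ioo).2 hae
  filter_upwards [this] with x hx
  exact sub_eq_zero.1 hx

variable {a b : ℝ} {d n : ℕ}

/-! ### Continuous representatives and integration by parts -/

theorem integrable_coeFn (u : L2 a b d) : Integrable u (μ a b) :=
  (Lp.memLp u).integrable (by norm_num)

theorem integrable_eval (u : L2 a b d) (i : Fin d) : Integrable (fun x => u x i) (μ a b) :=
  (integrable_coeFn u).eval_piLp i

theorem intervalIntegrable_coeFn (hab : a ≤ b) (u : L2 a b d) :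
    IntervalIntegrable u volume a b :=
  (intervalIntegrable_iff_integrableOn_Ioo_of_le hab).2 (integrable_coeFn u)

theorem eval_primitive (u : L2 a b d) {x : ℝ} (hx : x ∈ Icc a b) (i : Fin d) :
    (∫ t in a..x, u t) i = ∫ t in a..x, u t i := by
  rw [intervalIntegral.integral_of_le hx.1, intervalIntegral.integral_of_le hx.1,
    integral_Ioc_eq_integral_Ioo, integral_Ioc_eq_integral_Ioo]
  exact eval_integral_piLp (fun j => ((integrable_eval u j).mono_measure
    (Measure.restrict_mono (Ioo_subset_Ioo_right hx.2) le_rfl))) i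

theorem continuousOn_primitive (hab : a ≤ b) (u : L2 a b d) (c : EuclideanSpace ℝ (Fin d)) :
    ContinuousOn (fun x => c + ∫ t in a..x, u t) (Icc a b) := by
  have := intervalIntegral.continuousOn_primitive_interval' (intervalIntegrable_coeFn hab u)
    (left_mem_uIcc)
  rw [uIcc_of_le hab] at this
  exact continuousOn_const.add this

theorem memLp_primitive (hab : a ≤ b) (u : L2 a b d) (c : EuclideanSpace ℝ (Fin d)) :
    MemLp (fun x => c + ∫ t in a..x, u t) 2 (μ a b) := by
  have h := continuousOn_primitive hab u c
  obtain ⟨C, hC⟩ := isCompact_Icc.exists_bound_of_continuousOn h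
  refine MemLp.of_bound ((h.mono Ioo_subset_Icc_self).aestronglyMeasurable measurableSet_Ioo) C ?_
  exact (ae_restrict_iff' measurableSet_Ioo).2
    (Filter.Eventually.of_forall fun x hx => hC x (Ioo_subset_Icc_self hx))

theorem integral_deriv_smul_primitive (hab : a < b) (u : L2 a b d)
    (c : EuclideanSpace ℝ (Fin d)) {φ : ℝ → ℝ} (hφ : ContDiff ℝ ∞ φ) (hc : HasCompactSupport φ)
    (hs : tsupport φ ⊆ Ioo a b) :
    ∫ x, deriv φ x • (c + ∫ t in a..x, u t) ∂(μ a b) = -∫ x, φ x • u x ∂(μ a b) := by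
  have hφa : φ a = 0 := image_eq_zero_of_notMem_tsupport fun h => lt_irrefl _ (hs h).1
  have hφb : φ b = 0 := image_eq_zero_of_notMem_tsupport fun h => lt_irrefl _ (hs h).2
  have hφ' : Continuous (deriv φ) := hφ.continuous_deriv (by simp)
  have hFTC : ∀ x, ∫ t in a..x, deriv φ t = φ x := fun x => by
    rw [intervalIntegral.integral_deriv_eq_sub (fun y _ => (hφ.differentiable (by simp)) y)
      (hφ'.intervalIntegrable _ _), hφa, sub_zero]
  have hI1 : Integrable (fun x => deriv φ x • (c + ∫ t in a..x, u t)) (μ a b) := by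
    obtain ⟨C, hC⟩ := hc.deriv.exists_bound_of_continuous hφ'
    exact ((memLp_primitive hab.le u c).integrable (by norm_num)).bdd_smul C
      hφ'.aestronglyMeasurable (Filter.Eventually.of_forall hC)
  have hI2 := integrable_smul u hφ.continuous hc
  ext i
  rw [PiLp.neg_apply, eval_integral_piLp (fun j => hI1.eval_piLp j),
    eval_integral_piLp (fun j => hI2.eval_piLp j)]
  have key := integral_mul_primitive_add_primitive_mul hab.le
    (f := deriv φ) (g := fun x => u x i)
    ((hφ'.integrable_of_hasCompactSupport hc.deriv).integrableOn) (integrable_eval u i) 0 (c i)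
  simp only [hFTC, zero_add, hφb, zero_mul, sub_zero] at key
  rw [eq_neg_iff_add_eq_zero, ← integral_add (hI1.eval_piLp i) (hI2.eval_piLp i), ← key]
  refine setIntegral_congr_fun measurableSet_Ioo fun x hx => ?_
  simp only [PiLp.smul_apply, PiLp.add_apply, smul_eq_mul,
    eval_primitive u (Ioo_subset_Icc_self hx)]

/-- The function `x ↦ c + ∫_a^x u`. -/
def primitive (hab : a < b) (c : EuclideanSpace ℝ (Fin d)) (u : L2 a b d) : L2 a b d :=
  (memLp_primitive hab.le u c).toLp

theorem coeFn_primitive (hab : a < b) (c : EuclideanSpace ℝ (Fin d)) (u : L2 a b d) :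
    primitive hab c u =ᵐ[μ a b] fun x => c + ∫ t in a..x, u t :=
  MemLp.coeFn_toLp _

theorem isWeakDeriv_primitive (hab : a < b) (c : EuclideanSpace ℝ (Fin d)) (u : L2 a b d) :
    IsWeakDeriv (primitive hab c u) u := by
  intro φ hφ hc hs
  rw [← integral_deriv_smul_primitive hab u c hφ hc hs]
  refine integral_congr_ae ?_
  filter_upwards [coeFn_primitive hab c u] with x hx
  rw [hx]

theorem contValue_primitive (hab : a < b) (c : EuclideanSpace ℝ (Fin d)) (u : L2 a b d)
    {x : ℝ} (hx : x ∈ Icc a b) : contValue (primitive hab c u) x = c + ∫ t in a..x, u t :=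
  contValue_eq hab (continuousOn_primitive hab.le u c) (coeFn_primitive hab c u) hx

theorem contValue_primitive_left (hab : a < b) (c : EuclideanSpace ℝ (Fin d)) (u : L2 a b d) :
    contValue (primitive hab c u) a = c := by
  rw [contValue_primitive hab c u (left_mem_Icc.2 hab.le), intervalIntegral.integral_same, add_zero]

/-- A function with a weak derivative is a primitive of it. -/
theorem IsWeakDeriv.eq_primitive (hab : a < b) {u v : L2 a b d} (h : IsWeakDeriv u v) :
    u = primitive hab (contValue u a) v := by
  have h1 : IsWeakDeriv (u - primitive hab 0 v) 0 := by
    have := h.add ((isWeakDeriv_primitive hab 0 v).smul (-1))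
    simpa [sub_eq_add_neg] using this
  obtain ⟨c, hc⟩ := exists_ae_eq_const hab (integrable_coeFn (u - primitive hab 0 v)) (by
    intro φ hφ hφc hs
    rw [h1 φ hφ hφc hs, neg_eq_zero]
    refine integral_eq_zero_of_ae ?_
    filter_upwards [Lp.coeFn_zero (EuclideanSpace ℝ (Fin d)) 2 (μ a b)] with x hx
    rw [hx]
    exact smul_zero _)
  have h2 : u = primitive hab c v := by
    refine Lp.ext ?_
    filter_upwards [hc, Lp.coeFn_sub u (primitive hab 0 v), coeFn_primitive hab 0 v,
      coeFn_primitive hab c v] with x h1 h2 h3 h4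
    rw [h2, Pi.sub_apply, h3, zero_add, sub_eq_iff_eq_add] at h1
    rw [h1, h4]
  have h3 : contValue u a = c := by rw [h2, contValue_primitive_left]
  rw [h3]
  exact h2

theorem IsWeakDeriv.contValue_eq (hab : a < b) {u v : L2 a b d} (h : IsWeakDeriv u v)
    {x : ℝ} (hx : x ∈ Icc a b) : contValue u x = contValue u a + ∫ t in a..x, v t := by
  conv_lhs => rw [h.eq_primitive hab]
  exact contValue_primitive hab _ v hx

theorem IsWeakDeriv.continuousOn_contValue (hab : a < b) {u v : L2 a b d} (h : IsWeakDeriv u v) :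
    ContinuousOn (contValue u) (Icc a b) :=
  (continuousOn_primitive hab.le v (contValue u a)).congr fun _ hx => h.contValue_eq hab hx

theorem IsWeakDeriv.ae_eq_contValue (hab : a < b) {u v : L2 a b d} (h : IsWeakDeriv u v) :
    u =ᵐ[μ a b] contValue u := by
  have h1 : u =ᵐ[μ a b] fun x => contValue u a + ∫ t in a..x, v t := by
    conv_lhs => rw [h.eq_primitive hab]
    exact coeFn_primitive hab _ v
  filter_upwards [h1, ae_restrict_mem measurableSet_Ioo] with x hx hx'
  rw [hx, h.contValue_eq hab (Ioo_subset_Icc_self hx')]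

theorem IsWeakDeriv.contValue_add (hab : a < b) {u v u' v' : L2 a b d} (h : IsWeakDeriv u v)
    (h' : IsWeakDeriv u' v') {x : ℝ} (hx : x ∈ Icc a b) :
    contValue (u + u') x = contValue u x + contValue u' x := by
  refine PortHamiltonian.contValue_eq hab (f := fun x => contValue u x + contValue u' x)
    ((h.continuousOn_contValue hab).add (h'.continuousOn_contValue hab)) ?_ hx
  filter_upwards [h.ae_eq_contValue hab, h'.ae_eq_contValue hab, Lp.coeFn_add u u'] with x h1 h2 h3
  rw [h3, Pi.add_apply, h1, h2]

theorem IsWeakDeriv.contValue_smul (hab : a < b) {u v : L2 a b d} (r : ℝ) (h : IsWeakDeriv u v)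
    {x : ℝ} (hx : x ∈ Icc a b) : contValue (r • u) x = r • contValue u x := by
  refine PortHamiltonian.contValue_eq hab (f := fun x => r • contValue u x)
    ((h.continuousOn_contValue hab).const_smul r) ?_ hx
  filter_upwards [h.ae_eq_contValue hab, Lp.coeFn_smul r u] with x h1 h3
  rw [h3, Pi.smul_apply, h1]

/-- Multiplication of an `L₂` function by a constant matrix. -/
abbrev matMul (P : Matrix (Fin d) (Fin d) ℝ) : L2 a b d →L[ℝ] L2 a b d :=
  (Matrix.toEuclideanCLM (𝕜 := ℝ) P).compLpL 2 (μ a b)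

theorem coeFn_matMul (P : Matrix (Fin d) (Fin d) ℝ) (u : L2 a b d) :
    matMul P u =ᵐ[μ a b] fun x => Matrix.toEuclideanCLM (𝕜 := ℝ) P (u x) :=
  ContinuousLinearMap.coeFn_compLpL _ u

theorem IsWeakDeriv.matMul (P : Matrix (Fin d) (Fin d) ℝ) {u v : L2 a b d} (h : IsWeakDeriv u v) :
    IsWeakDeriv (matMul P u) (matMul P v) := by
  intro φ hφ hc hs
  have key : ∀ (w : L2 a b d) (ψ : ℝ → ℝ), Continuous ψ → HasCompactSupport ψ →
      ∫ x, ψ x • PortHamiltonian.matMul P w x ∂(μ a b)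
        = Matrix.toEuclideanCLM (𝕜 := ℝ) P (∫ x, ψ x • w x ∂(μ a b)) := by
    intro w ψ h1 h2
    rw [← ContinuousLinearMap.integral_comp_comm _ (integrable_smul w h1 h2)]
    refine integral_congr_ae ?_
    filter_upwards [coeFn_matMul P w] with x hx
    rw [hx, map_smul]
  rw [key _ _ (hφ.continuous_deriv (by simp)) hc.deriv, key _ _ hφ.continuous hc,
    h φ hφ hc hs, map_neg]

theorem IsWeakDeriv.contValue_matMul (hab : a < b) (P : Matrix (Fin d) (Fin d) ℝ) {u v : L2 a b d}
    (h : IsWeakDeriv u v) {x : ℝ} (hx : x ∈ Icc a b) :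
    contValue (PortHamiltonian.matMul P u) x
      = Matrix.toEuclideanCLM (𝕜 := ℝ) P (contValue u x) := by
  refine PortHamiltonian.contValue_eq hab
    (f := fun x => Matrix.toEuclideanCLM (𝕜 := ℝ) P (contValue u x))
    ((Matrix.toEuclideanCLM (𝕜 := ℝ) P).continuous.comp_continuousOn
      (h.continuousOn_contValue hab)) ?_ hx
  filter_upwards [h.ae_eq_contValue hab, coeFn_matMul P u] with x h1 h3
  rw [h3, h1]

/-- Integration by parts for weak derivatives. -/
theorem IsWeakDeriv.inner_add_inner (hab : a < b) {u v u' v' : L2 a b d} (h : IsWeakDeriv u v)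
    (h' : IsWeakDeriv u' v') :
    inner ℝ v u' + inner ℝ u v' = inner ℝ (contValue u b) (contValue u' b)
      - inner ℝ (contValue u a) (contValue u' a) := by
  have hI1 : Integrable (fun x => inner ℝ (v x) (u' x)) (μ a b) := L2.integrable_inner v u'
  have hI2 : Integrable (fun x => inner ℝ (u x) (v' x)) (μ a b) := L2.integrable_inner u v'
  rw [L2.inner_def, L2.inner_def, ← integral_add hI1 hI2]
  have hb : b ∈ Icc a b := right_mem_Icc.2 hab.le
  have hx' : ∀ i, IntegrableOn (fun x => v x i * (contValue u' a i + ∫ t in a..x, v' t i)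
      + (contValue u a i + ∫ t in a..x, v t i) * v' x i) (Ioo a b) := by
    intro i
    have hc : ∀ (w : L2 a b d) (r : ℝ), ContinuousOn (fun x => r + ∫ t in a..x, w t i)
        (uIcc a b) := fun w r => continuousOn_const.add
      (intervalIntegral.continuousOn_primitive_interval'
        ((intervalIntegrable_iff_integrableOn_Ioo_of_le hab.le).2 (integrable_eval w i))
        left_mem_uIcc)
    have hi : ∀ w : L2 a b d, IntervalIntegrable (fun x => w x i) volume a b := fun w =>
      (intervalIntegrable_iff_integrableOn_Ioo_of_le hab.le).2 (integrable_eval w i)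
    rw [← intervalIntegrable_iff_integrableOn_Ioo_of_le hab.le]
    exact ((hi v).mul_continuousOn (hc v' _)).add ((hi v').continuousOn_mul (hc v _))
  calc ∫ x, inner ℝ (v x) (u' x) + inner ℝ (u x) (v' x) ∂(μ a b)
      = ∫ x in Ioo a b, ∑ i, (v x i * (contValue u' a i + ∫ t in a..x, v' t i)
          + (contValue u a i + ∫ t in a..x, v t i) * v' x i) := by
        refine integral_congr_ae ?_
        filter_upwards [h.ae_eq_contValue hab, h'.ae_eq_contValue hab,
          ae_restrict_mem measurableSet_Ioo] with x h1 h2 hx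
        have hx := Ioo_subset_Icc_self hx
        rw [h1, h2, h.contValue_eq hab hx, h'.contValue_eq hab hx, PiLp.inner_apply,
          PiLp.inner_apply, ← Finset.sum_add_distrib]
        refine Finset.sum_congr rfl fun i _ => ?_
        simp only [PiLp.add_apply, eval_primitive _ hx, RCLike.inner_apply, conj_trivial]
        ring
    _ = ∑ i, (contValue u b i * contValue u' b i - contValue u a i * contValue u' a i) := by
        rw [integral_finsetSum _ fun i _ => hx' i]
        refine Finset.sum_congr rfl fun i _ => ?_
        rw [integral_mul_primitive_add_primitive_mul hab.le (integrable_eval v i)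
          (integrable_eval v' i), h.contValue_eq hab hb, h'.contValue_eq hab hb,
          PiLp.add_apply, PiLp.add_apply, eval_primitive _ hb, eval_primitive _ hb]
    _ = _ := by
        rw [PiLp.inner_apply, PiLp.inner_apply, ← Finset.sum_sub_distrib]
        refine Finset.sum_congr rfl fun i _ => ?_
        simp only [RCLike.inner_apply, conj_trivial]
        ring

/-! ### Green's identity -/

theorem trace_add (hab : a < b) {t : ℝ} (ht : t ∈ Icc a b) (u v : sobolev a b d n) :
    trace t (u + v) = trace t u + trace t v := by
  funext p
  simp only [trace, map_add, Pi.add_apply, (jet_succ u p.1).contValue_add hab (jet_succ v p.1) ht,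
    PiLp.add_apply]

theorem trace_smul (hab : a < b) {t : ℝ} (ht : t ∈ Icc a b) (r : ℝ) (u : sobolev a b d n) :
    trace t (r • u) = r • trace t u := by
  funext p
  simp only [trace, map_smul, Pi.smul_apply, (jet_succ u p.1).contValue_smul hab r ht,
    PiLp.smul_apply]

/-- The trace at `t ∈ [a,b]` as a linear map. -/
def traceₗ (hab : a < b) {t : ℝ} (ht : t ∈ Icc a b) :
    sobolev a b d n →ₗ[ℝ] (Fin n × Fin d → ℝ) where
  toFun := trace t
  map_add' := trace_add hab ht
  map_smul' := trace_smul hab ht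

theorem inner_toEuclideanCLM_left {ι : Type*} [Fintype ι] [DecidableEq ι] (M : Matrix ι ι ℝ)
    (x y : EuclideanSpace ℝ ι) :
    inner ℝ (Matrix.toEuclideanCLM (𝕜 := ℝ) M x) y
      = inner ℝ x (Matrix.toEuclideanCLM (𝕜 := ℝ) M.transpose y) := by
  have h : M.transpose = star M := by
    rw [Matrix.star_eq_conjTranspose, Matrix.conjTranspose_eq_transpose_of_trivial]
  rw [h, map_star, ContinuousLinearMap.star_eq_adjoint, ContinuousLinearMap.adjoint_inner_right]

theorem inner_matMul (P : Matrix (Fin d) (Fin d) ℝ) (u v : L2 a b d) :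
    inner ℝ (matMul P u) v = inner ℝ u (matMul P.transpose v) := by
  rw [L2.inner_def, L2.inner_def]
  refine integral_congr_ae ?_
  filter_upwards [coeFn_matMul P u, coeFn_matMul P.transpose v] with x h1 h2
  rw [h1, h2]
  exact inner_toEuclideanCLM_left P (u x) (v x)

/-- The boundary term `⟨P u, v⟩(b) - ⟨P u, v⟩(a)` of an integration by parts. -/
def boundaryTerm (P : Matrix (Fin d) (Fin d) ℝ) (u v : L2 a b d) : ℝ :=
  inner ℝ (Matrix.toEuclideanCLM (𝕜 := ℝ) P (contValue u b)) (contValue v b)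
    - inner ℝ (Matrix.toEuclideanCLM (𝕜 := ℝ) P (contValue u a)) (contValue v a)

/-- Integrating by parts `j` times. -/
theorem inner_matMul_iterate (hab : a < b) (P : Matrix (Fin d) (Fin d) ℝ) {w : ℕ → L2 a b d}
    {k : ℕ} (hw : ∀ i < k, IsWeakDeriv (w i) (w (i + 1))) {j : ℕ} (hj : j ≤ k) :
    inner ℝ (matMul P (w k)) (w 0) = ∑ i ∈ Finset.range j, (-1) ^ i *
        boundaryTerm P (w (k - 1 - i)) (w i)
      + (-1) ^ j * inner ℝ (matMul P (w (k - j))) (w j) := by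
  induction j with
  | zero => simp
  | succ j ih =>
    have h1 : IsWeakDeriv (w (k - 1 - j)) (w (k - j)) := by
      have := hw (k - 1 - j) (by omega)
      rwa [show k - 1 - j + 1 = k - j by omega] at this
    have h2 := (h1.matMul P).inner_add_inner hab (hw j (by omega))
    rw [h1.contValue_matMul hab P (right_mem_Icc.2 hab.le),
      h1.contValue_matMul hab P (left_mem_Icc.2 hab.le)] at h2
    rw [ih (by omega), Finset.sum_range_succ, boundaryTerm, ← h2,
      show k - (j + 1) = k - 1 - j by omega]
    ring

/-- Integrating by parts `k` times against a matrix with `Pᵀ = (-1)^{k+1} P` leaves only boundary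
terms. -/
theorem two_mul_inner_matMul (hab : a < b) {P : Matrix (Fin d) (Fin d) ℝ} {w : ℕ → L2 a b d}
    {k : ℕ} (hP : P.transpose = (-1 : ℝ) ^ (k + 1) • P)
    (hw : ∀ i < k, IsWeakDeriv (w i) (w (i + 1))) :
    2 * inner ℝ (matMul P (w k)) (w 0) = ∑ i ∈ Finset.range k, (-1) ^ i *
        boundaryTerm P (w (k - 1 - i)) (w i) := by
  have h := inner_matMul_iterate hab P hw le_rfl
  have h2 : matMul ((-1 : ℝ) ^ (k + 1) • P) (w k) = (-1 : ℝ) ^ (k + 1) • matMul P (w k) := by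
    refine Lp.ext ?_
    filter_upwards [coeFn_matMul ((-1 : ℝ) ^ (k + 1) • P) (w k), coeFn_matMul P (w k),
      Lp.coeFn_smul ((-1 : ℝ) ^ (k + 1)) (matMul P (w k))] with x h1 h2 h3
    rw [h1, h3, Pi.smul_apply, h2, map_smul]
    rfl
  rw [Nat.sub_self, inner_matMul P (w 0) (w k), hP, h2, inner_smul_right, ← mul_assoc, ← pow_add,
    show k + (k + 1) = 2 * k + 1 by ring, pow_succ, pow_mul, neg_one_sq, one_pow,
    real_inner_comm (matMul P (w k))] at h
  linarith

/-- The coefficients `P₀, …, Pₙ` continued by zero. -/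
def extend (P : Fin (n + 1) → Matrix (Fin d) (Fin d) ℝ) (k : ℕ) : Matrix (Fin d) (Fin d) ℝ :=
  if h : k < n + 1 then P ⟨k, h⟩ else 0

/-- Summing over the order `k` of the derivative and the number `i < k` of integrations by parts is
summing over the blocks `(i, j)` of `Q`, `k = i + j + 1`. -/
theorem sum_range_range_antidiagonal (n : ℕ) (f : ℕ → ℕ → ℝ) (hf : ∀ k, n < k → ∀ i, f k i = 0) :
    ∑ k ∈ Finset.range (n + 1), ∑ i ∈ Finset.range k, f k i
      = ∑ i ∈ Finset.range n, ∑ j ∈ Finset.range n, f (i + j + 1) i := by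
  rw [Finset.sum_comm' (t' := Finset.range n) (s' := fun i => Finset.Ico (i + 1) (n + 1))
    (fun x y => by simp only [Finset.mem_range, Finset.mem_Ico]; omega)]
  refine Finset.sum_congr rfl fun i hi => ?_
  have hi := Finset.mem_range.1 hi
  rw [Finset.sum_Ico_eq_sum_range]
  refine Finset.sum_subset_zero_on_sdiff (fun x hx => ?_) (fun x hx => ?_) (fun x hx => ?_)
  · simp only [Finset.mem_range] at hx ⊢; omega
  · refine hf _ ?_ _
    simp only [Finset.mem_sdiff, Finset.mem_range] at hx; omega
  · congr 1; ring

theorem Q_apply (P : Fin (n + 1) → Matrix (Fin d) (Fin d) ℝ) (p q : Fin n × Fin d) :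
    Q P p q = (-1) ^ (p.1 : ℕ) * extend P ((p.1 : ℕ) + q.1 + 1) p.2 q.2 := by
  rw [Q, Matrix.of_apply, extend]
  split_ifs <;> simp

theorem dotProduct_Q_mulVec (P : Fin (n + 1) → Matrix (Fin d) (Fin d) ℝ)
    (y : ℕ → EuclideanSpace ℝ (Fin d)) :
    (fun p : Fin n × Fin d => y p.1 p.2) ⬝ᵥ (Q P).mulVec (fun p : Fin n × Fin d => y p.1 p.2)
      = ∑ i ∈ Finset.range n, ∑ j ∈ Finset.range n, (-1) ^ i *
          inner ℝ (Matrix.toEuclideanCLM (𝕜 := ℝ) (extend P (i + j + 1)) (y j)) (y i) := by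
  rw [Finset.sum_range fun i => ∑ j ∈ Finset.range n, (-1) ^ i *
          inner ℝ (Matrix.toEuclideanCLM (𝕜 := ℝ) (extend P (i + j + 1)) (y j)) (y i)]
  simp only [Finset.sum_range, dotProduct, Matrix.mulVec, Fintype.sum_prod_type, Q_apply,
    PiLp.inner_apply, Matrix.ofLp_toEuclideanCLM, RCLike.inner_apply, conj_trivial,
    Finset.mul_sum]
  refine Finset.sum_congr rfl fun i _ => ?_
  rw [Finset.sum_comm]
  refine Finset.sum_congr rfl fun j _ => Finset.sum_congr rfl fun α _ =>
    Finset.sum_congr rfl fun β _ => ?_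
  ring

/-- **Green's identity**: the formal skew-symmetry of `∑ P_k ∂^k` up to the boundary form of `Q`. -/
theorem two_mul_inner_sum_matMul (hab : a < b) {P : Fin (n + 1) → Matrix (Fin d) (Fin d) ℝ}
    (hP : ∀ j : Fin (n + 1), (P j).transpose = (-1 : ℝ) ^ ((j : ℕ) + 1) • P j)
    (u : sobolev a b d n) :
    2 * inner ℝ (∑ k, matMul (P k) (jet a b d n u k)) (u : L2 a b d)
      = trace b u ⬝ᵥ (Q P).mulVec (trace b u) - trace a u ⬝ᵥ (Q P).mulVec (trace a u) := by
  set w : ℕ → L2 a b d := fun k => if h : k < n + 1 then jet a b d n u ⟨k, h⟩ else 0 with hw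
  have hwk : ∀ k : Fin (n + 1), jet a b d n u k = w k := fun k => by
    simp only [hw, k.2, dif_pos, Fin.eta]
  have hw0 : (u : L2 a b d) = w 0 := by rw [← jet_zero u, hwk]; rfl
  have hwd : ∀ i < n, IsWeakDeriv (w i) (w (i + 1)) := fun i hi => by
    have := jet_succ u ⟨i, hi⟩
    rwa [hwk, hwk] at this
  have htr : ∀ t, trace t u = fun p : Fin n × Fin d => contValue (w p.1) t p.2 := fun t => by
    funext p
    rw [trace, hwk]
    rfl
  have hPk : ∀ k : Fin (n + 1), P k = extend P k := fun k => by
    simp only [extend, k.2, dif_pos, Fin.eta]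
  rw [htr b, htr a, dotProduct_Q_mulVec P fun i => contValue (w i) b,
    dotProduct_Q_mulVec P fun i => contValue (w i) a, ← Finset.sum_sub_distrib,
    sum_inner, Finset.mul_sum]
  simp only [← Finset.sum_sub_distrib, ← mul_sub]
  have hsum := sum_range_range_antidiagonal n
    (fun k i => (-1) ^ i * boundaryTerm (extend P k) (w (k - 1 - i)) (w i)) (fun k hk i => by
      rw [extend, dif_neg (by omega), boundaryTerm]
      simp)
  have e : ∀ i j : ℕ, i + j + 1 - 1 - i = j := fun i j => by omega
  simp only [e] at hsum
  simp only [boundaryTerm] at hsum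
  rw [← hsum, Finset.sum_range]
  refine Finset.sum_congr rfl fun k _ => ?_
  rw [hw0, hwk k, hPk k]
  exact two_mul_inner_matMul hab (by rw [← hPk]; exact hP k) fun i hi => hwd i (by omega)

/-! ### Multiplication by an exponential weight -/

theorem exists_bound_exp (a b l : ℝ) : ∃ C : ℝ, ∀ᵐ x ∂(μ a b), ‖Real.exp (l * x)‖ ≤ C := by
  obtain ⟨C, hC⟩ := (isCompact_Icc (a := a) (b := b)).exists_bound_of_continuousOn
    (f := fun x => Real.exp (l * x)) (by fun_prop)
  exact ⟨C, (ae_restrict_iff' measurableSet_Ioo).2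
    (Filter.Eventually.of_forall fun x hx => hC x (Ioo_subset_Icc_self hx))⟩

theorem memLp_exp_smul (l : ℝ) (u : L2 a b d) :
    MemLp (fun x => Real.exp (l * x) • u x) 2 (μ a b) := by
  obtain ⟨C, hC⟩ := exists_bound_exp a b l
  exact (Lp.memLp u).smul (p := ∞) (MemLp.of_bound
    (Continuous.aestronglyMeasurable (by fun_prop)) C hC)

/-- Multiplication by the weight `x ↦ exp (l x)` on `L₂(a,b)^d`. -/
def expMul (l : ℝ) : L2 a b d →ₗ[ℝ] L2 a b d where
  toFun u := (memLp_exp_smul l u).toLp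
  map_add' u v := by
    rw [← MemLp.toLp_add, MemLp.toLp_eq_toLp_iff]
    filter_upwards [Lp.coeFn_add u v] with x hx
    simp only [hx, Pi.add_apply, smul_add]
  map_smul' r u := by
    rw [RingHom.id_apply, ← MemLp.toLp_const_smul, MemLp.toLp_eq_toLp_iff]
    filter_upwards [Lp.coeFn_smul r u] with x hx
    simp only [hx, Pi.smul_apply, smul_comm r]

theorem coeFn_expMul (l : ℝ) (u : L2 a b d) :
    expMul l u =ᵐ[μ a b] fun x => Real.exp (l * x) • u x :=
  MemLp.coeFn_toLp (memLp_exp_smul l u)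

theorem expMul_neg_expMul (l : ℝ) (u : L2 a b d) : expMul (-l) (expMul l u) = u := by
  refine Lp.ext ?_
  filter_upwards [coeFn_expMul (-l) (expMul l u), coeFn_expMul l u] with x h1 h2
  rw [h1, h2, smul_smul, ← Real.exp_add]
  simp

theorem expMul_matMul (l : ℝ) (P : Matrix (Fin d) (Fin d) ℝ) (u : L2 a b d) :
    expMul l (matMul P u) = matMul P (expMul l u) := by
  refine Lp.ext ?_
  filter_upwards [coeFn_expMul l (matMul P u), coeFn_expMul l u, coeFn_matMul P u,
    coeFn_matMul P (expMul l u)] with x h1 h2 h3 h4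
  rw [h1, h3, h4, h2, map_smul]

theorem coeFn_mulL2 {𝓗 : ℝ → Matrix (Fin d) (Fin d) ℝ}
    (h𝓗 : ∀ i j, MemLp (fun x => 𝓗 x i j) ∞ (μ a b)) (u : L2 a b d) :
    mulL2 𝓗 h𝓗 u =ᵐ[μ a b] fun x => Matrix.toEuclideanLin (𝓗 x) (u x) :=
  MemLp.coeFn_toLp (memLp_mul h𝓗 u)

theorem expMul_mulL2 {𝓗 : ℝ → Matrix (Fin d) (Fin d) ℝ}
    (h𝓗 : ∀ i j, MemLp (fun x => 𝓗 x i j) ∞ (μ a b)) (l : ℝ) (u : L2 a b d) :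
    expMul l (mulL2 𝓗 h𝓗 u) = mulL2 𝓗 h𝓗 (expMul l u) := by
  refine Lp.ext ?_
  filter_upwards [coeFn_expMul l (mulL2 𝓗 h𝓗 u), coeFn_expMul l u, coeFn_mulL2 h𝓗 u,
    coeFn_mulL2 h𝓗 (expMul l u)] with x h1 h2 h3 h4
  rw [h1, h3, h4, h2, map_smul]

/-- The product rule for the weight `x ↦ exp (l x)`. -/
theorem IsWeakDeriv.expMul (l : ℝ) {u v : L2 a b d} (h : IsWeakDeriv u v) :
    IsWeakDeriv (expMul l u) (expMul l v + l • expMul l u) := by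
  intro φ hφ hc hs
  have hE : ContDiff ℝ ∞ fun x : ℝ => Real.exp (l * x) := by fun_prop
  have hcE : HasCompactSupport fun x => φ x * Real.exp (l * x) := hc.mul_right
  have hd : ∀ x, deriv (fun x => φ x * Real.exp (l * x)) x
      = deriv φ x * Real.exp (l * x) + l * (φ x * Real.exp (l * x)) := by
    intro x
    have h1 := ((hφ.differentiable (by simp)) x).hasDerivAt
    have h2 : HasDerivAt (fun x : ℝ => Real.exp (l * x)) (Real.exp (l * x) * (l * 1)) x :=
      ((hasDerivAt_id x).const_mul l).exp
    rw [(h1.fun_mul h2).deriv]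
    ring
  have key := h (fun x => φ x * Real.exp (l * x)) (hφ.mul hE) hcE
    ((tsupport_mul_subset_left).trans hs)
  have hφ' : Continuous (deriv φ) := hφ.continuous_deriv (by simp)
  have i1 : Integrable (fun x => (deriv φ x * Real.exp (l * x)) • u x) (μ a b) :=
    integrable_smul u (hφ'.mul hE.continuous) hc.deriv.mul_right
  have i2 : Integrable (fun x => (l * (φ x * Real.exp (l * x))) • u x) (μ a b) :=
    integrable_smul u (continuous_const.mul (hφ.continuous.mul hE.continuous)) hcE.mul_left
  have i3 : Integrable (fun x => (φ x * Real.exp (l * x)) • v x) (μ a b) :=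
    integrable_smul v (hφ.continuous.mul hE.continuous) hcE
  have e1 : ∫ x, deriv φ x • PortHamiltonian.expMul l u x ∂(μ a b)
      = ∫ x, (deriv φ x * Real.exp (l * x)) • u x ∂(μ a b) := by
    refine integral_congr_ae ?_
    filter_upwards [coeFn_expMul l u] with x hx
    rw [hx, smul_smul]
  have e2 : ∫ x, φ x • (PortHamiltonian.expMul l v + l • PortHamiltonian.expMul l u : L2 a b d) x
        ∂(μ a b)
      = ∫ x, (φ x * Real.exp (l * x)) • v x ∂(μ a b)
        + ∫ x, (l * (φ x * Real.exp (l * x))) • u x ∂(μ a b) := by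
    rw [← integral_add i3 i2]
    refine integral_congr_ae ?_
    filter_upwards [coeFn_expMul l u, coeFn_expMul l v,
      Lp.coeFn_add (PortHamiltonian.expMul l v) (l • PortHamiltonian.expMul l u),
      Lp.coeFn_smul l (PortHamiltonian.expMul l u)] with x h1 h2 h3 h4
    rw [h3, Pi.add_apply, h4, Pi.smul_apply, h1, h2, smul_add, smul_smul, smul_smul, smul_smul]
    congr 2
    ring
  simp only [hd, add_smul] at key
  rw [integral_add i1 i2] at key
  rw [e1, e2, neg_add, ← key]
  abel

theorem IsWeakDeriv.contValue_expMul (hab : a < b) (l : ℝ) {u v : L2 a b d} (h : IsWeakDeriv u v)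
    {x : ℝ} (hx : x ∈ Icc a b) :
    contValue (PortHamiltonian.expMul l u) x = Real.exp (l * x) • contValue u x := by
  refine PortHamiltonian.contValue_eq hab (f := fun x => Real.exp (l * x) • contValue u x)
    (ContinuousOn.smul (f := fun x => Real.exp (l * x)) (by fun_prop)
      (h.continuousOn_contValue hab)) ?_ hx
  filter_upwards [h.ae_eq_contValue hab, coeFn_expMul l u] with x h1 h3
  rw [h3, h1]

/-! ### The Volterra operator -/

/-- The Volterra operator `u ↦ ∫_a^· u`. -/
def volterra (hab : a < b) : L2 a b d →ₗ[ℝ] L2 a b d where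
  toFun := primitive hab 0
  map_add' u v := by
    have h := (isWeakDeriv_primitive hab 0 u).add (isWeakDeriv_primitive hab 0 v)
    rw [h.eq_primitive hab, (isWeakDeriv_primitive hab 0 u).contValue_add hab
      (isWeakDeriv_primitive hab 0 v) (left_mem_Icc.2 hab.le), contValue_primitive_left,
      contValue_primitive_left, add_zero]
  map_smul' r u := by
    have h := (isWeakDeriv_primitive hab 0 u).smul r
    rw [RingHom.id_apply, h.eq_primitive hab, (isWeakDeriv_primitive hab 0 u).contValue_smul hab r
      (left_mem_Icc.2 hab.le), contValue_primitive_left, smul_zero]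

theorem primitive_eq_add_volterra (hab : a < b) (c : EuclideanSpace ℝ (Fin d)) (u v : L2 a b d) :
    primitive hab c (u + v) = primitive hab c u + volterra hab v := by
  have h2 : IsWeakDeriv (volterra hab v) v := isWeakDeriv_primitive hab 0 v
  have h := (isWeakDeriv_primitive hab c u).add h2
  rw [h.eq_primitive hab, (isWeakDeriv_primitive hab c u).contValue_add hab
      h2 (left_mem_Icc.2 hab.le), contValue_primitive_left, volterra]
  simp [contValue_primitive_left]

/-- In the norm with weight `exp (-l x)` the Volterra operator has norm at most `1 / l`. This is
the energy estimate for `y' = -l y + exp (-l x) u`, `y(a) = 0`. -/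
theorem norm_expMul_volterra_le (hab : a < b) {l : ℝ} (hl : 0 < l) (u : L2 a b d) :
    ‖expMul (-l) (volterra hab u)‖ ≤ l⁻¹ * ‖expMul (-l) u‖ := by
  have h0 : IsWeakDeriv (volterra hab u) u := isWeakDeriv_primitive hab 0 u
  have h := h0.expMul (-l)
  set y := expMul (-l) (volterra hab u) with hy
  have hya : contValue y a = 0 := by
    have h1 : contValue (volterra hab u) a = 0 := contValue_primitive_left hab 0 u
    rw [hy, h0.contValue_expMul hab _ (left_mem_Icc.2 hab.le), h1, smul_zero]
  have h1 := h.inner_add_inner hab h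
  rw [hya, inner_zero_left, sub_zero, real_inner_comm, ← two_mul, inner_add_right, inner_smul_right,
    real_inner_self_eq_norm_sq, real_inner_self_eq_norm_sq] at h1
  have h2 := real_inner_le_norm y (expMul (-l) u)
  have h3 := sq_nonneg ‖contValue y b‖
  rw [← div_eq_inv_mul, le_div_iff₀ hl]
  rcases (norm_nonneg y).eq_or_lt with h4 | h4
  · rw [← h4, zero_mul]
    exact norm_nonneg _
  · nlinarith

theorem norm_expMul_volterra_pow_le (hab : a < b) {l : ℝ} (hl : 1 ≤ l) (u : L2 a b d) (j : ℕ) :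
    ‖expMul (-l) ((volterra hab ^ (j + 1)) u)‖ ≤ l⁻¹ * ‖expMul (-l) u‖ := by
  have hl0 : 0 < l := one_pos.trans_le hl
  induction j with
  | zero => simpa using norm_expMul_volterra_le hab hl0 u
  | succ j ih =>
    rw [pow_succ', Module.End.mul_apply]
    refine (norm_expMul_volterra_le hab hl0 _).trans ?_
    refine le_trans ?_ ih
    exact mul_le_of_le_one_left (norm_nonneg _) (inv_le_one_of_one_le₀ hl)

/-- `1 + K` is onto if `K` is a strict contraction in an equivalent norm `‖E ·‖`. -/
theorem exists_add_eq_of_norm_le {X : Type*} [NormedAddCommGroup X] [NormedSpace ℝ X]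
    [CompleteSpace X] (E E' K : X →ₗ[ℝ] X) (h1 : ∀ x, E (E' x) = x) (h2 : ∀ x, E' (E x) = x)
    {r : ℝ} (hr0 : 0 ≤ r) (hr : r < 1) (hK : ∀ x, ‖E (K x)‖ ≤ r * ‖E x‖) (f : X) :
    ∃ x, x + K x = f := by
  let T : X →L[ℝ] X := (E ∘ₗ K ∘ₗ E').mkContinuous r fun x => by
    simpa [h1] using hK (E' x)
  have hT : ‖T‖ ≤ r := LinearMap.mkContinuous_norm_le _ hr0 _
  have hu : IsUnit (1 - -T) := isUnit_one_sub_of_norm_lt_one (by rw [norm_neg]; linarith)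
  obtain ⟨S, hS⟩ := hu.exists_right_inv
  have hz : S (E f) + E (K (E' (S (E f)))) = E f := by
    have := congrArg (fun A : X →L[ℝ] X => A (E f)) hS
    simpa [T] using this
  refine ⟨E' (S (E f)), ?_⟩
  rw [← h2 (E' (S (E f)) + K (E' (S (E f)))), map_add E, h1, hz, h2]

/-! ### Initial value problems -/

/-- The `j`-th iterated primitive of `g`, where the `(i+1)`-st integration takes the value `η i`
at `a`. -/
def iteratedPrimitive (hab : a < b) (η : ℕ → EuclideanSpace ℝ (Fin d)) (g : L2 a b d) :
    ℕ → L2 a b d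
  | 0 => g
  | j + 1 => primitive hab (η j) (iteratedPrimitive hab η g j)

theorem iteratedPrimitive_eq (hab : a < b) (η : ℕ → EuclideanSpace ℝ (Fin d)) (g : L2 a b d)
    (j : ℕ) : iteratedPrimitive hab η g j
      = iteratedPrimitive hab η 0 j + (volterra hab ^ j) g := by
  induction j with
  | zero => simp [iteratedPrimitive]
  | succ j ih =>
    rw [iteratedPrimitive, ih, primitive_eq_add_volterra, pow_succ', Module.End.mul_apply,
      iteratedPrimitive]

/-- The initial value problem `w^{(n)} + ∑_{k<n} C_k w^{(k)} = f`, `w^{(k)}(a) = η_k`, has a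
solution in `Hⁿ(a,b)^d` if the bounded operators `C_k` commute with exponential weights. -/
theorem exists_jets_initialValue (hab : a < b) (C : Fin n → L2 a b d →L[ℝ] L2 a b d)
    (hC : ∀ k l u, expMul l (C k u) = C k (expMul l u)) (η : Fin n → EuclideanSpace ℝ (Fin d))
    (f : L2 a b d) : ∃ w ∈ jets a b d n, (∀ k : Fin n, contValue (w k.castSucc) a = η k) ∧
      w (Fin.last n) + ∑ k : Fin n, C k (w k.castSucc) = f := by
  -- The first integration yields the derivative of order `n - 1`, so the initial values are used
  -- in reverse order.
  set η' : ℕ → EuclideanSpace ℝ (Fin d) := fun j => if h : j < n then η (Fin.rev ⟨j, h⟩) else 0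
    with hη'
  have hw : ∀ (g : L2 a b d) (k : Fin n),
      iteratedPrimitive hab η' g (n - (k.castSucc : Fin (n + 1)))
      = primitive hab (η k) (iteratedPrimitive hab η' g (n - (k.succ : Fin (n + 1)))) := by
    intro g k
    have e1 : n - ((k.castSucc : Fin (n + 1)) : ℕ) = (Fin.rev k : ℕ) + 1 := by
      rw [Fin.val_castSucc, Fin.val_rev]; omega
    have e2 : n - ((k.succ : Fin (n + 1)) : ℕ) = (Fin.rev k : ℕ) := by
      rw [Fin.val_succ, Fin.val_rev]
    rw [e1, e2, iteratedPrimitive, hη']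
    simp only [Fin.is_lt, dif_pos, Fin.eta, Fin.rev_rev]
  -- In terms of `g = w^{(n)}` the equation is `g + K g = f - …` with `K = ∑ C_k V^{n-k}`; each
  -- `V^{n-k}` contributes a factor `1 / l` in the norm with weight `exp (-l x)`.
  set M : ℝ := ∑ k, ‖C k‖ with hM
  have hM0 : 0 ≤ M := Finset.sum_nonneg fun k _ => norm_nonneg _
  set l : ℝ := M + 1 with hl
  let K : L2 a b d →ₗ[ℝ] L2 a b d :=
    ∑ k : Fin n, (C k).toLinearMap ∘ₗ (volterra hab ^ (n - (k : ℕ)))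
  have hKa : ∀ g, K g = ∑ k : Fin n, C k ((volterra hab ^ (n - (k : ℕ))) g) := fun g => by
    simp [K, LinearMap.sum_apply]
  have hK : ∀ g, ‖expMul (-l) (K g)‖ ≤ (M * l⁻¹) * ‖expMul (-l) g‖ := by
    intro g
    rw [hKa, map_sum]
    refine (norm_sum_le _ _).trans ?_
    rw [hM, Finset.sum_mul, Finset.sum_mul]
    refine Finset.sum_le_sum fun k _ => ?_
    rw [hC, mul_assoc]
    refine ((C k).le_opNorm _).trans (mul_le_mul_of_nonneg_left ?_ (norm_nonneg _))
    rw [show n - (k : ℕ) = (n - 1 - k) + 1 by omega]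
    exact norm_expMul_volterra_pow_le hab (by linarith) g _
  have hr : M * l⁻¹ < 1 := by
    rw [← div_eq_mul_inv, div_lt_one (by linarith)]
    linarith
  obtain ⟨g, hg⟩ := exists_add_eq_of_norm_le (expMul (-l)) (expMul l) K
    (fun x => expMul_neg_expMul l x) (fun x => by simpa using expMul_neg_expMul (-l) x)
    (mul_nonneg hM0 (inv_nonneg.2 (by linarith))) hr hK
    (f - ∑ k : Fin n, C k (iteratedPrimitive hab η' 0 (n - (k : ℕ))))
  refine ⟨fun k => iteratedPrimitive hab η' g (n - k), fun k => ?_, fun k => ?_, ?_⟩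
  · show IsWeakDeriv (iteratedPrimitive hab η' g (n - (k.castSucc : Fin (n + 1)))) _
    rw [hw]
    exact isWeakDeriv_primitive hab _ _
  · show contValue (iteratedPrimitive hab η' g (n - (k.castSucc : Fin (n + 1)))) a = _
    rw [hw, contValue_primitive_left]
  · simp only [Fin.val_last, Nat.sub_self, Fin.val_castSucc]
    rw [Finset.sum_congr rfl fun k _ => by rw [iteratedPrimitive_eq hab η' g, map_add],
      Finset.sum_add_distrib, ← hKa, add_left_comm]
    rw [show iteratedPrimitive hab η' g 0 = g from rfl, hg]
    abel

/-! ### Multiplication by `𝓗` and the resolvent equation -/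

theorem matMul_matMul (P R : Matrix (Fin d) (Fin d) ℝ) (u : L2 a b d) :
    matMul P (matMul R u) = matMul (P * R) u := by
  refine Lp.ext ?_
  filter_upwards [coeFn_matMul P (matMul R u), coeFn_matMul R u, coeFn_matMul (P * R) u]
    with x h1 h2 h3
  rw [h1, h2, h3, map_mul]
  rfl

theorem matMul_one (u : L2 a b d) : matMul (1 : Matrix (Fin d) (Fin d) ℝ) u = u := by
  refine Lp.ext ?_
  filter_upwards [coeFn_matMul (1 : Matrix (Fin d) (Fin d) ℝ) u] with x h1
  rw [h1, map_one]
  rfl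

theorem jet_eq {w : Fin (n + 1) → L2 a b d} (hw : w ∈ jets a b d n)
    (h : w 0 ∈ sobolev a b d n) : jet a b d n ⟨w 0, h⟩ = w := by
  have hj : jet a b d n ⟨w 0, h⟩ ∈ jets a b d n := fun k => jet_succ _ k
  have := @jetsFst_injective a b d n ⟨_, hj⟩ ⟨w, hw⟩ (jet_zero ⟨w 0, h⟩)
  exact congrArg Subtype.val this

section Weight

variable {𝓗 : ℝ → Matrix (Fin d) (Fin d) ℝ}
  (h𝓗 : ∀ i j, MemLp (fun x => 𝓗 x i j) ∞ (μ a b))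

theorem weightedInner_eq (u v : L2 a b d) :
    weightedInner 𝓗 u v = inner ℝ (mulL2 𝓗 h𝓗 u) v := by
  rw [weightedInner, L2.inner_def]
  refine integral_congr_ae ?_
  filter_upwards [coeFn_mulL2 h𝓗 u] with x hx
  rw [hx]

theorem inner_mulL2_left (hsymm : ∀ᵐ x ∂(μ a b), (𝓗 x).IsSymm) (u v : L2 a b d) :
    inner ℝ (mulL2 𝓗 h𝓗 u) v = inner ℝ u (mulL2 𝓗 h𝓗 v) := by
  rw [L2.inner_def, L2.inner_def]
  refine integral_congr_ae ?_
  filter_upwards [coeFn_mulL2 h𝓗 u, coeFn_mulL2 h𝓗 v, hsymm] with x h1 h2 h3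
  rw [h1, h2]
  have := inner_toEuclideanCLM_left (𝓗 x) (u x) (v x)
  rwa [h3.eq] at this

theorem le_inner_mulL2 {c : ℝ} (hc : ∀ᵐ x ∂(μ a b), ∀ v : EuclideanSpace ℝ (Fin d),
      c * ‖v‖ ^ 2 ≤ inner ℝ (Matrix.toEuclideanLin (𝓗 x) v) v) (u : L2 a b d) :
    c * ‖u‖ ^ 2 ≤ inner ℝ (mulL2 𝓗 h𝓗 u) u := by
  rw [← real_inner_self_eq_norm_sq, L2.inner_def, L2.inner_def, ← integral_const_mul]
  refine integral_mono_ae ((L2.integrable_inner u u).const_mul c) (L2.integrable_inner _ _) ?_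
  filter_upwards [hc, coeFn_mulL2 h𝓗 u] with x h1 h2
  rw [h2, real_inner_self_eq_norm_sq]
  exact h1 _

/-- The Lax–Milgram lemma for operators. -/
theorem exists_equiv_of_coercive {X : Type*} [NormedAddCommGroup X] [InnerProductSpace ℝ X]
    [CompleteSpace X] (T : X →L[ℝ] X) {c : ℝ} (hc : 0 < c)
    (h : ∀ x, c * ‖x‖ ^ 2 ≤ inner ℝ (T x) x) : ∃ e : X ≃L[ℝ] X, ∀ x, e x = T x := by
  have hco : IsCoercive ((innerSL ℝ).comp T) := ⟨c, hc, fun x => by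
    have := h x
    rw [pow_two, ← mul_assoc] at this
    exact this⟩
  refine ⟨hco.continuousLinearEquivOfBilin, fun x => ext_inner_right ℝ fun y => ?_⟩
  rw [hco.continuousLinearEquivOfBilin_apply]
  rfl

/-- Multiplication by `𝓗` is a topological isomorphism of `L₂(a,b)^d`. -/
theorem exists_equiv_mulL2 (hsymm : ∀ᵐ x ∂(μ a b), (𝓗 x).IsSymm)
    {c : ℝ} (hc0 : 0 < c) (hc : ∀ᵐ x ∂(μ a b), ∀ v : EuclideanSpace ℝ (Fin d),
      c * ‖v‖ ^ 2 ≤ inner ℝ (Matrix.toEuclideanLin (𝓗 x) v) v) :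
    ∃ e : L2 a b d ≃L[ℝ] L2 a b d, ∀ u, e u = mulL2 𝓗 h𝓗 u := by
  have hs : (mulL2 𝓗 h𝓗).IsSymmetric := inner_mulL2_left h𝓗 hsymm
  exact exists_equiv_of_coercive ⟨mulL2 𝓗 h𝓗, hs.continuous⟩ hc0 (le_inner_mulL2 h𝓗 hc)

variable {P : Fin (n + 1) → Matrix (Fin d) (Fin d) ℝ}

theorem portHamiltonian_apply (u : (portHamiltonian P 𝓗 h𝓗).domain) :
    portHamiltonian P 𝓗 h𝓗 u
      = ∑ k, matMul (P k) (jet a b d n ⟨mulL2 𝓗 h𝓗 u, u.2⟩ k) := by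
  change (∑ k : Fin (n + 1),
    ((Matrix.toEuclideanCLM (𝕜 := ℝ) (P k)).compLpL 2 (μ a b)).toLinearMap ∘ₗ
      LinearMap.proj k ∘ₗ jet a b d n ∘ₗ (mulL2 𝓗 h𝓗).restrict (fun _ hu => hu)) u = _
  rw [LinearMap.sum_apply]
  rfl

theorem two_mul_weightedInner_portHamiltonian (hab : a < b)
    (hP : ∀ j : Fin (n + 1), (P j).transpose = (-1 : ℝ) ^ ((j : ℕ) + 1) • P j)
    (hsymm : ∀ᵐ x ∂(μ a b), (𝓗 x).IsSymm) (u : (portHamiltonian P 𝓗 h𝓗).domain) :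
    2 * weightedInner 𝓗 (portHamiltonian P 𝓗 h𝓗 u) u
      = trace b (⟨mulL2 𝓗 h𝓗 u, u.2⟩ : sobolev a b d n) ⬝ᵥ
          (Q P).mulVec (trace b (⟨mulL2 𝓗 h𝓗 u, u.2⟩ : sobolev a b d n))
        - trace a (⟨mulL2 𝓗 h𝓗 u, u.2⟩ : sobolev a b d n) ⬝ᵥ
          (Q P).mulVec (trace a (⟨mulL2 𝓗 h𝓗 u, u.2⟩ : sobolev a b d n)) := by
  rw [weightedInner_eq h𝓗, inner_mulL2_left h𝓗 hsymm, portHamiltonian_apply]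
  exact two_mul_inner_sum_matMul hab hP ⟨mulL2 𝓗 h𝓗 u, u.2⟩

/-- The equation `u + A u = f` is solvable for any prescribed initial trace of `𝓗 u`. -/
theorem exists_add_portHamiltonian_eq (hab : a < b)
    (hP : ∀ j : Fin (n + 1), (P j).transpose = (-1 : ℝ) ^ ((j : ℕ) + 1) • P j)
    (hPn : (P (Fin.last n)).det ≠ 0) (hsymm : ∀ᵐ x ∂(μ a b), (𝓗 x).IsSymm)
    {c : ℝ} (hc0 : 0 < c) (hc : ∀ᵐ x ∂(μ a b), ∀ v : EuclideanSpace ℝ (Fin d),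
      c * ‖v‖ ^ 2 ≤ inner ℝ (Matrix.toEuclideanLin (𝓗 x) v) v)
    (f : L2 a b d) (η : Fin n × Fin d → ℝ) :
    ∃ u : (portHamiltonian P 𝓗 h𝓗).domain, (u : L2 a b d) + portHamiltonian P 𝓗 h𝓗 u = f ∧
      trace a (⟨mulL2 𝓗 h𝓗 u, u.2⟩ : sobolev a b d n) = η := by
  obtain ⟨e, he⟩ := exists_equiv_mulL2 h𝓗 hsymm hc0 hc
  suffices h : ∃ w ∈ jets a b d n, e.symm (w 0) + ∑ k, matMul (P k) (w k) = f ∧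
      ∀ p : Fin n × Fin d, contValue (w p.1.castSucc) a p.2 = η p by
    obtain ⟨w, hw, h1, h2⟩ := h
    have hmem : w 0 ∈ sobolev a b d n := ⟨⟨w, hw⟩, rfl⟩
    have hu : mulL2 𝓗 h𝓗 (e.symm (w 0)) = w 0 := by rw [← he, e.apply_symm_apply]
    have hu' : mulL2 𝓗 h𝓗 (e.symm (w 0)) ∈ sobolev a b d n := by rwa [hu]
    have hsub : (⟨mulL2 𝓗 h𝓗 (e.symm (w 0)), hu'⟩ : sobolev a b d n) = ⟨w 0, hmem⟩ :=
      Subtype.ext hu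
    refine ⟨⟨e.symm (w 0), hu'⟩, ?_, ?_⟩
    · rw [portHamiltonian_apply]
      simp only [hsub, jet_eq hw hmem, h1]
    · funext p
      simp only [hsub, trace, jet_eq hw hmem, h2]
  rcases n with _ | m
  · -- Without derivatives the equation is solved by coercivity: multiplied by `𝓗` it reads
    -- `𝓗 u + 𝓗 P₀ 𝓗 u = 𝓗 f`, and `𝓗 P₀ 𝓗` is skew-symmetric.
    obtain ⟨e', he'⟩ := exists_equiv_of_coercive
      (e.toContinuousLinearMap ∘L (1 + matMul (P 0) ∘L e.toContinuousLinearMap)) hc0 (fun u => by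
        have h1 := two_mul_inner_matMul (k := 0) (w := fun _ => e u) hab (hP 0)
          (fun i hi => absurd hi (Nat.not_lt_zero i))
        have h2 := le_inner_mulL2 h𝓗 hc u
        have h3 := inner_mulL2_left h𝓗 hsymm (matMul (P 0) (e u)) u
        simp only [Finset.range_zero, Finset.sum_empty] at h1
        rw [← he, ← he] at h3
        rw [← he] at h2
        show _ ≤ inner ℝ (e (u + matMul (P 0) (e u))) u
        rw [map_add, inner_add_left, h3]
        linarith)
    refine ⟨fun _ => e (e'.symm (e f)), fun k => k.elim0, ?_, fun p => p.1.elim0⟩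
    have h1 := he' (e'.symm (e f))
    rw [e'.apply_symm_apply] at h1
    have h2 : f = e'.symm (e f) + matMul (P 0) (e (e'.symm (e f))) := e.injective h1
    conv_rhs => rw [h2]
    simp
  · -- After multiplication by `P_n⁻¹` the equation for `w = 𝓗 u` is an initial value problem; the
    -- term `u = 𝓗⁻¹ w` is part of the coefficient of order zero.
    set R := (P (Fin.last (m + 1)))⁻¹ with hR
    have hPR : P (Fin.last (m + 1)) * R = 1 :=
      Matrix.mul_nonsing_inv _ (isUnit_iff_ne_zero.2 hPn)
    have hexp : ∀ l u, expMul l (e.symm u) = e.symm (expMul l u) := fun l u => by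
      apply e.injective
      rw [e.apply_symm_apply, he, ← expMul_mulL2, ← he, e.apply_symm_apply]
    let D : Fin (m + 1) → L2 a b d →L[ℝ] L2 a b d := fun k =>
      if k = 0 then e.symm.toContinuousLinearMap else 0
    have hD : ∀ k l u, expMul l (D k u) = D k (expMul l u) := fun k l u => by
      by_cases hk : k = 0
      · simp only [D, if_pos hk]
        exact hexp l u
      · simp only [D, if_neg hk]
        exact map_zero _
    obtain ⟨w, hw, hη, heq⟩ := exists_jets_initialValue hab
      (fun k : Fin (m + 1) => matMul R ∘L (matMul (P k.castSucc) + D k))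
      (fun k l u => by
        show expMul l (matMul R (matMul (P k.castSucc) u + D k u))
          = matMul R (matMul (P k.castSucc) (expMul l u) + D k (expMul l u))
        rw [expMul_matMul, map_add, expMul_matMul, hD])
      (fun k => WithLp.toLp 2 fun α => η (k, α)) (matMul R f)
    refine ⟨w, hw, ?_, fun p => by rw [hη]⟩
    have h1 : matMul (P (Fin.last (m + 1))) (w (Fin.last (m + 1)) + ∑ k : Fin (m + 1),
        matMul R (matMul (P k.castSucc) (w k.castSucc) + D k (w k.castSucc)))
        = matMul (P (Fin.last (m + 1))) (matMul R f) := congrArg _ heq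
    rw [map_add, map_sum] at h1
    simp only [matMul_matMul _ R, hPR, matMul_one] at h1
    rw [Finset.sum_add_distrib] at h1
    have h2 : ∑ k : Fin (m + 1), D k (w k.castSucc) = e.symm (w 0) := by
      rw [Finset.sum_eq_single 0 (fun k _ hk => by simp only [D, if_neg hk]; rfl)
        (fun h => by simp at h)]
      simp only [D, if_pos]
      rfl
    rw [h2] at h1
    rw [Fin.sum_univ_castSucc, ← h1]
    abel

end Weight

/-! ### Contractions and maximal nonnegative subspaces -/

section Matrices

variable {ι : Type*} [Fintype ι]

/-- The square roots `p`, `m` of the positive and the negative part of a symmetric matrix `A`,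
described by the algebraic relations between them; their positivity is not required. -/
structure IsRootPair (A p m : Matrix ι ι ℝ) : Prop where
  transpose_left : p.transpose = p
  transpose_right : m.transpose = m
  mul_eq_zero : p * m = 0
  mul_eq_zero' : m * p = 0
  sub_eq : p * p - m * m = A

/-- The matrix with rows `(p, m)` and `(m, p)`. -/
abbrev pairBlock (p m : Matrix ι ι ℝ) : Matrix (ι ⊕ ι) (ι ⊕ ι) ℝ := Matrix.fromBlocks p m m p

theorem pairBlock_mulVec (p m : Matrix ι ι ℝ) (y z : ι → ℝ) :
    (pairBlock p m).mulVec (Sum.elim y z)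
      = Sum.elim (p.mulVec y + m.mulVec z) (m.mulVec y + p.mulVec z) := by
  rw [Matrix.fromBlocks_mulVec]
  rfl

theorem IsRootPair.transpose_pairBlock {A p m : Matrix ι ι ℝ} (h : IsRootPair A p m) :
    (pairBlock p m).transpose = pairBlock p m := by
  rw [Matrix.fromBlocks_transpose, h.transpose_left, h.transpose_right]

theorem norm_toLp_sq (v : ι → ℝ) : ‖(WithLp.toLp 2 v : EuclideanSpace ℝ ι)‖ ^ 2 = v ⬝ᵥ v := by
  rw [EuclideanSpace.real_norm_sq_eq]
  simp [dotProduct, pow_two]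

theorem dotProduct_mul_transpose_mulVec {κ : Type*} [Fintype κ] (M : Matrix ι κ ℝ) (v : ι → ℝ) :
    v ⬝ᵥ (M * M.transpose).mulVec v = M.transpose.mulVec v ⬝ᵥ M.transpose.mulVec v := by
  rw [← Matrix.mulVec_mulVec, Matrix.dotProduct_mulVec, ← Matrix.mulVec_transpose]

theorem isHermitian_mul_transpose {ι κ : Type*} [Fintype κ] (M : Matrix ι κ ℝ) :
    (M * M.transpose).IsHermitian := by
  rw [← Matrix.conjTranspose_eq_transpose_of_trivial]
  exact Matrix.isHermitian_mul_conjTranspose_self M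

theorem eq_zero_of_rank_eq_card {κ : Type*} [Fintype κ] {X : Matrix ι κ ℝ}
    (hX : X.rank = Fintype.card ι) {v : ι → ℝ} (hv : X.transpose.mulVec v = 0) : v = 0 := by
  have h1 := LinearMap.finrank_range_add_finrank_ker X.transpose.mulVecLin
  rw [← Matrix.rank, Matrix.rank_transpose, hX, Module.finrank_fintype_fun_eq_card,
    Nat.add_eq_left, Submodule.finrank_eq_zero] at h1
  have : v ∈ LinearMap.ker X.transpose.mulVecLin := hv
  rwa [h1, Submodule.mem_bot] at this

/-- The coordinates `F = p y + m z`, `G = m y + p z` diagonalise the boundary form. -/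
theorem IsRootPair.dotProduct_sub_dotProduct {A p m : Matrix ι ι ℝ} (h : IsRootPair A p m)
    (y z : ι → ℝ) :
    (p.mulVec y + m.mulVec z) ⬝ᵥ (p.mulVec y + m.mulVec z)
      - (m.mulVec y + p.mulVec z) ⬝ᵥ (m.mulVec y + p.mulVec z)
      = y ⬝ᵥ A.mulVec y - z ⬝ᵥ A.mulVec z := by
  have e : ∀ (R S : Matrix ι ι ℝ) (v w : ι → ℝ), R.mulVec v ⬝ᵥ S.mulVec w
      = v ⬝ᵥ (R.transpose * S).mulVec w := fun R S v w => by
    rw [← Matrix.mulVec_mulVec, Matrix.dotProduct_mulVec v, Matrix.vecMul_transpose]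
  simp only [add_dotProduct, dotProduct_add, e, h.transpose_left, h.transpose_right, h.mul_eq_zero,
    h.mul_eq_zero', Matrix.zero_mulVec, dotProduct_zero, ← h.sub_eq, Matrix.sub_mulVec,
    dotProduct_sub]
  ring

section DecEq

variable [DecidableEq ι]

/-- The matrix with rows `(-A, A)` and `(1, 1)`. -/
abbrev rowsBlock (A : Matrix ι ι ℝ) : Matrix (ι ⊕ ι) (ι ⊕ ι) ℝ := Matrix.fromBlocks (-A) A 1 1

/-- The matrix exchanging the two components. -/
abbrev swapBlock (ι : Type*) [DecidableEq ι] : Matrix (ι ⊕ ι) (ι ⊕ ι) ℝ :=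
  Matrix.fromBlocks 0 1 1 0

/-- The diagonal matrix with diagonal blocks `-r` and `r`. -/
abbrev signBlock (ι : Type*) [DecidableEq ι] (r : ℝ) : Matrix (ι ⊕ ι) (ι ⊕ ι) ℝ :=
  Matrix.fromBlocks (-r • 1) 0 0 (r • 1)

theorem isRootPair_cfc {A : Matrix ι ι ℝ} (hA : A.IsHermitian) :
    IsRootPair A (cfc (fun l : ℝ => √(max l 0)) A) (cfc (fun l : ℝ => √(max (-l) 0)) A) := by
  have hA' : IsSelfAdjoint A := hA
  have hzero : ∀ l : ℝ, √(max l 0) * √(max (-l) 0) = 0 := fun l => by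
    rcases le_total l 0 with h | h
    · rw [max_eq_right h, Real.sqrt_zero, zero_mul]
    · rw [max_eq_right (neg_nonpos.2 h), Real.sqrt_zero, mul_zero]
  have ht : ∀ f : ℝ → ℝ, (cfc f A).transpose = cfc f A := fun f => by
    have : IsSelfAdjoint (cfc f A) := cfc_predicate f A
    rw [← Matrix.conjTranspose_eq_transpose_of_trivial]
    exact this
  refine ⟨ht _, ht _, ?_, ?_, ?_⟩
  · rw [← cfc_mul _ _ A]
    simp only [hzero, cfc_const_zero]
  · rw [← cfc_mul _ _ A]
    simp only [fun l : ℝ => (mul_comm _ _).trans (hzero l), cfc_const_zero]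
  · rw [← cfc_mul _ _ A, ← cfc_mul _ _ A, ← cfc_sub _ _ A]
    conv_rhs => rw [← cfc_id ℝ A]
    refine cfc_congr fun l _ => ?_
    simp only [Real.mul_self_sqrt (le_max_right _ _), id]
    rcases le_total l 0 with h | h
    · rw [max_eq_right h, max_eq_left (neg_nonneg.2 h)]; ring
    · rw [max_eq_right (neg_nonpos.2 h), max_eq_left h]; ring

namespace IsRootPair

variable {A p m : Matrix ι ι ℝ} (h : IsRootPair A p m)
include h

theorem isUnit_det_pairBlock (hA : A.det ≠ 0) : IsUnit (pairBlock p m).det := by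
  -- `p² + m²` is the absolute value of `A`, and the square of the block matrix is block diagonal
  -- with blocks `p² + m²`.
  have hs : (p * p + m * m) * (p * p + m * m) = A * A := by
    have e1 : p * p * (m * m) = 0 := by
      rw [Matrix.mul_assoc, ← Matrix.mul_assoc p m m, h.mul_eq_zero, zero_mul, mul_zero]
    have e2 : m * m * (p * p) = 0 := by
      rw [Matrix.mul_assoc, ← Matrix.mul_assoc m p p, h.mul_eq_zero', zero_mul, mul_zero]
    rw [← h.sub_eq, add_mul, mul_add, mul_add, sub_mul, mul_sub, mul_sub, e1, e2]
    abel
  have hd : (p * p + m * m).det ≠ 0 := fun h0 => by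
    have := congrArg Matrix.det hs
    rw [Matrix.det_mul, Matrix.det_mul, h0, zero_mul] at this
    exact mul_ne_zero hA hA this.symm
  have hT : pairBlock p m * pairBlock p m
      = Matrix.fromBlocks (p * p + m * m) 0 0 (p * p + m * m) := by
    rw [Matrix.fromBlocks_multiply, h.mul_eq_zero, h.mul_eq_zero', add_zero, add_comm (m * m)]
  rw [isUnit_iff_ne_zero]
  intro h0
  have := congrArg Matrix.det hT
  rw [Matrix.det_mul, h0, zero_mul, Matrix.det_fromBlocks_zero₂₁] at this
  exact mul_ne_zero hd hd this.symm

theorem pairBlock_mul_mul : pairBlock p m * Matrix.fromBlocks 1 0 0 (-1) * pairBlock p m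
    = Matrix.fromBlocks A 0 0 (-A) := by
  rw [Matrix.fromBlocks_multiply, Matrix.fromBlocks_multiply, ← h.sub_eq]
  simp [h.mul_eq_zero, h.mul_eq_zero', sub_eq_add_neg, add_comm]

/-- With `e = -A y + A z`, `f = y + z` one has `e · f = -(|p y + m z|² - |m y + p z|²)`. This is the
corresponding identity between the inverses of the two Gram matrices. -/
theorem inv_mul_swap_mul_inv (hA : A.transpose = A) :
    (rowsBlock A)⁻¹ * swapBlock ι *
        (rowsBlock A)⁻¹.transpose
      = (pairBlock p m)⁻¹ * signBlock ι (1 / 2) *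
        (pairBlock p m)⁻¹.transpose := by
  have hJ : (swapBlock ι)⁻¹
      = swapBlock ι := by
    refine Matrix.inv_eq_right_inv ?_
    rw [Matrix.fromBlocks_multiply]
    simp
  have hσ : (signBlock ι 2)⁻¹
      = signBlock ι (1 / 2) := by
    refine Matrix.inv_eq_right_inv ?_
    rw [Matrix.fromBlocks_multiply]
    simp [smul_smul]
  have hσ' : signBlock ι 2
      = (-2 : ℝ) • Matrix.fromBlocks 1 0 0 (-1) := by
    rw [Matrix.fromBlocks_smul]
    simp
  have key : (rowsBlock A).transpose * swapBlock ι *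
      rowsBlock A
      = pairBlock p m * signBlock ι 2 * pairBlock p m := by
    rw [hσ', Matrix.mul_smul, Matrix.smul_mul, h.pairBlock_mul_mul, Matrix.fromBlocks_transpose,
      Matrix.fromBlocks_multiply, Matrix.fromBlocks_multiply, Matrix.fromBlocks_smul,
      Matrix.transpose_neg, hA]
    congr 1 <;> simp [two_smul]
  have key' := congrArg Inv.inv key
  rw [Matrix.mul_inv_rev, Matrix.mul_inv_rev, Matrix.mul_inv_rev, Matrix.mul_inv_rev, hJ,
    hσ] at key'
  rw [Matrix.transpose_nonsing_inv, Matrix.transpose_nonsing_inv, h.transpose_pairBlock,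
    Matrix.mul_assoc, key', Matrix.mul_assoc]

end IsRootPair

theorem norm_toEuclideanCLM_transpose (M : Matrix ι ι ℝ) :
    ‖Matrix.toEuclideanCLM (𝕜 := ℝ) M.transpose‖ = ‖Matrix.toEuclideanCLM (𝕜 := ℝ) M‖ := by
  have h : M.transpose = star M := by
    rw [Matrix.star_eq_conjTranspose, Matrix.conjTranspose_eq_transpose_of_trivial]
  rw [h, map_star, ContinuousLinearMap.star_eq_adjoint, LinearIsometryEquiv.norm_map]

theorem norm_toEuclideanCLM_sq (M : Matrix ι ι ℝ) (v : ι → ℝ) :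
    ‖Matrix.toEuclideanCLM (𝕜 := ℝ) M (WithLp.toLp 2 v)‖ ^ 2 = M.mulVec v ⬝ᵥ M.mulVec v := by
  rw [EuclideanSpace.real_norm_sq_eq]
  simp [dotProduct, pow_two]

theorem norm_toEuclideanCLM_le_one_iff (M : Matrix ι ι ℝ) :
    ‖Matrix.toEuclideanCLM (𝕜 := ℝ) M‖ ≤ 1 ↔ ∀ v, M.mulVec v ⬝ᵥ M.mulVec v ≤ v ⬝ᵥ v := by
  constructor
  · intro h v
    rw [← norm_toEuclideanCLM_sq, ← norm_toLp_sq]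
    gcongr
    exact (ContinuousLinearMap.le_opNorm _ _).trans (mul_le_of_le_one_left (norm_nonneg _) h)
  · intro h
    refine ContinuousLinearMap.opNorm_le_bound _ zero_le_one fun x => ?_
    rw [one_mul]
    have := h x.ofLp
    rw [← norm_toEuclideanCLM_sq, ← norm_toLp_sq] at this
    exact (sq_le_sq₀ (norm_nonneg _) (norm_nonneg _)).1 this

theorem posSemidef_one_sub_mul_transpose_iff (M : Matrix ι ι ℝ) :
    (1 - M * M.transpose).PosSemidef ↔ ‖Matrix.toEuclideanCLM (𝕜 := ℝ) M‖ ≤ 1 := by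
  rw [← norm_toEuclideanCLM_transpose, norm_toEuclideanCLM_le_one_iff,
    Matrix.posSemidef_iff_dotProduct_mulVec]
  simp only [star_trivial, Matrix.sub_mulVec, Matrix.one_mulVec, dotProduct_sub,
    dotProduct_mul_transpose_mulVec, sub_nonneg, and_iff_right_iff_imp]
  intro _
  exact Matrix.isHermitian_one.sub (isHermitian_mul_transpose M)

theorem rank_fromCols_neg_one (M : Matrix ι ι ℝ) :
    (Matrix.fromCols M (-1 : Matrix ι ι ℝ)).rank = Fintype.card ι := by
  refine le_antisymm (Matrix.rank_le_card_height _) ?_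
  have h : Matrix.fromCols M (-1 : Matrix ι ι ℝ) *
      Matrix.fromRows (0 : Matrix ι ι ℝ) (-1 : Matrix ι ι ℝ) = 1 := by
    rw [Matrix.fromCols_mul_fromRows]
    simp
  have := Matrix.rank_mul_le_left (Matrix.fromCols M (-1 : Matrix ι ι ℝ))
    (Matrix.fromRows (0 : Matrix ι ι ℝ) (-1 : Matrix ι ι ℝ))
  rwa [h, Matrix.rank_one] at this

theorem fromCols_mul_sign_mul (X Y : Matrix ι ι ℝ) :
    Matrix.fromCols X Y * signBlock ι (1 / 2) *
      (Matrix.fromCols X Y).transpose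
      = (1 / 2 : ℝ) • (Y * Y.transpose - X * X.transpose) := by
  rw [Matrix.fromCols_mul_fromBlocks, Matrix.transpose_fromCols, Matrix.fromCols_mul_fromRows]
  simp [smul_sub]
  abel

/-- If `Y Yᵀ - X Xᵀ ≥ 0` and `(X, Y)` has full rank, then `(X, Y)` is a multiple of `(M, -1)` with
a contraction `M`. -/
theorem exists_contraction_of_posSemidef {X Y : Matrix ι ι ℝ}
    (hr : (Matrix.fromCols X Y).rank = Fintype.card ι)
    (hps : (Y * Y.transpose - X * X.transpose).PosSemidef) :
    ∃ M : Matrix ι ι ℝ, ‖Matrix.toEuclideanCLM (𝕜 := ℝ) M‖ ≤ 1 ∧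
      ∀ F G : ι → ℝ, X.mulVec F + Y.mulVec G = 0 ↔ M.mulVec F = G := by
  -- If `Yᵀ v = 0`, then `0 ≤ -|Xᵀ v|²`, so `v` is orthogonal to all columns of `(X, Y)`.
  have hdet : Y.det ≠ 0 := by
    intro h0
    rw [← Matrix.det_transpose] at h0
    obtain ⟨v, hv0, hv⟩ := Matrix.exists_mulVec_eq_zero_iff.2 h0
    have h1 := hps.dotProduct_mulVec_nonneg v
    rw [star_trivial, Matrix.sub_mulVec, dotProduct_sub, dotProduct_mul_transpose_mulVec,
      dotProduct_mul_transpose_mulVec, hv, zero_dotProduct, zero_sub, neg_nonneg] at h1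
    have h2 : X.transpose.mulVec v = 0 :=
      dotProduct_self_eq_zero.1 (le_antisymm h1 (Finset.sum_nonneg fun i _ => mul_self_nonneg _))
    refine hv0 (eq_zero_of_rank_eq_card hr ?_)
    rw [Matrix.transpose_fromCols, Matrix.fromRows_mulVec, h2, hv]
    simp
  have hu : IsUnit Y.det := isUnit_iff_ne_zero.2 hdet
  refine ⟨-(Y⁻¹ * X), ?_, fun F G => ?_⟩
  · rw [← posSemidef_one_sub_mul_transpose_iff]
    have h1 := hps.mul_mul_conjTranspose_same Y⁻¹
    rw [Matrix.conjTranspose_eq_transpose_of_trivial, Matrix.mul_sub, Matrix.sub_mul,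
      ← Matrix.mul_assoc, Matrix.nonsing_inv_mul _ hu, Matrix.one_mul,
      ← Matrix.transpose_mul, Matrix.nonsing_inv_mul _ hu, Matrix.transpose_one] at h1
    rw [Matrix.transpose_neg, Matrix.neg_mul, Matrix.mul_neg, neg_neg, Matrix.transpose_mul]
    simpa only [Matrix.mul_assoc] using h1
  · rw [Matrix.neg_mulVec, ← Matrix.mulVec_mulVec]
    constructor
    · intro h
      have := congrArg Y⁻¹.mulVec h
      rw [Matrix.mulVec_add, Matrix.mulVec_mulVec _ Y⁻¹ Y, Matrix.nonsing_inv_mul _ hu,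
        Matrix.one_mulVec, Matrix.mulVec_zero] at this
      exact neg_eq_of_add_eq_zero_right this
    · rintro rfl
      rw [Matrix.mulVec_neg, Matrix.mulVec_mulVec _ Y Y⁻¹, Matrix.mul_nonsing_inv _ hu,
        Matrix.one_mulVec, add_neg_cancel]

/-- The sign condition on a kernel representation `W`, in the coordinates in which the boundary
form is `|F|² - |G|²`. -/
theorem IsRootPair.kernel_form_eq {A p m : Matrix ι ι ℝ} (h : IsRootPair A p m)
    (hA : A.transpose = A) (W : Matrix ι (ι ⊕ ι) ℝ) (X Y : Matrix ι ι ℝ)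
    (hW : W * (pairBlock p m)⁻¹ = Matrix.fromCols X Y) :
    W * (rowsBlock A)⁻¹ * swapBlock ι * (W * (rowsBlock A)⁻¹).transpose
      = (1 / 2 : ℝ) • (Y * Y.transpose - X * X.transpose) := by
  calc W * (rowsBlock A)⁻¹ * swapBlock ι * (W * (rowsBlock A)⁻¹).transpose
      = W * ((rowsBlock A)⁻¹ * swapBlock ι * (rowsBlock A)⁻¹.transpose) * W.transpose := by
        rw [Matrix.transpose_mul]
        simp only [Matrix.mul_assoc]
    _ = W * (pairBlock p m)⁻¹ * signBlock ι (1 / 2) * (W * (pairBlock p m)⁻¹).transpose := by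
        rw [h.inv_mul_swap_mul_inv hA, Matrix.transpose_mul W]
        simp only [Matrix.mul_assoc]
    _ = _ := by rw [hW, fromCols_mul_sign_mul]

namespace IsRootPair

variable {A p m : Matrix ι ι ℝ} (h : IsRootPair A p m) (hA : A.transpose = A) (hdet : A.det ≠ 0)
include h hA hdet

/-- The graph of a contraction is the kernel of a matrix with the sign condition. -/
theorem exists_kernel_of_contraction {M : Matrix ι ι ℝ}
    (hM : ‖Matrix.toEuclideanCLM (𝕜 := ℝ) M‖ ≤ 1) :
    ∃ W : Matrix ι (ι ⊕ ι) ℝ, W.rank = Fintype.card ι ∧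
      (W * (rowsBlock A)⁻¹ * swapBlock ι * (W * (rowsBlock A)⁻¹).transpose).PosSemidef ∧
      ∀ y z, W.mulVec (Sum.elim y z) = 0 ↔
        M.mulVec (p.mulVec y + m.mulVec z) = m.mulVec y + p.mulVec z := by
  have hu := h.isUnit_det_pairBlock hdet
  refine ⟨Matrix.fromCols M (-1 : Matrix ι ι ℝ) * pairBlock p m, ?_, ?_, fun y z => ?_⟩
  · rw [Matrix.rank_mul_eq_left_of_isUnit_det _ _ hu, rank_fromCols_neg_one]
  · rw [h.kernel_form_eq hA _ M (-1) (by
      rw [Matrix.mul_assoc, Matrix.mul_nonsing_inv _ hu, Matrix.mul_one])]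
    refine Matrix.PosSemidef.smul ?_ (by norm_num)
    have := (posSemidef_one_sub_mul_transpose_iff M).2 hM
    simpa using this
  · rw [← Matrix.mulVec_mulVec, pairBlock_mulVec, Matrix.fromCols_mulVec_sumElim,
      Matrix.neg_mulVec, Matrix.one_mulVec, ← sub_eq_add_neg, sub_eq_zero]

/-- The kernel of a matrix of full rank with the sign condition is the graph of a contraction. -/
theorem exists_contraction_of_kernel {W : Matrix ι (ι ⊕ ι) ℝ} (hr : W.rank = Fintype.card ι)
    (hW : (W * (rowsBlock A)⁻¹ * swapBlock ι * (W * (rowsBlock A)⁻¹).transpose).PosSemidef) :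
    ∃ M : Matrix ι ι ℝ, ‖Matrix.toEuclideanCLM (𝕜 := ℝ) M‖ ≤ 1 ∧
      ∀ y z, M.mulVec (p.mulVec y + m.mulVec z) = m.mulVec y + p.mulVec z ↔
        W.mulVec (Sum.elim y z) = 0 := by
  have hu := h.isUnit_det_pairBlock hdet
  obtain ⟨X, Y, hXY⟩ : ∃ X Y, W * (pairBlock p m)⁻¹ = Matrix.fromCols X Y :=
    ⟨_, _, (Matrix.fromCols_toCols _).symm⟩
  have hWX : W = Matrix.fromCols X Y * pairBlock p m := by
    rw [← hXY, Matrix.mul_assoc, Matrix.nonsing_inv_mul _ hu, Matrix.mul_one]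
  rw [h.kernel_form_eq hA W X Y hXY] at hW
  have hps : (Y * Y.transpose - X * X.transpose).PosSemidef := by
    have := hW.smul (show (0 : ℝ) ≤ 2 by norm_num)
    rwa [smul_smul, mul_one_div_cancel two_ne_zero, one_smul] at this
  rw [hWX, Matrix.rank_mul_eq_left_of_isUnit_det _ _ hu] at hr
  obtain ⟨M, hM, hMk⟩ := exists_contraction_of_posSemidef hr hps
  refine ⟨M, hM, fun y z => ?_⟩
  rw [hWX, ← Matrix.mulVec_mulVec, pairBlock_mulVec, Matrix.fromCols_mulVec_sumElim, hMk]

end IsRootPair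

/-- If `|G u| ≤ |F u|` for all `u`, then `G = M F` for a contraction `M`. -/
theorem exists_contraction_mulVec_eq {X : Type*} [AddCommGroup X] [Module ℝ X]
    (F G : X →ₗ[ℝ] ι → ℝ) (hFG : ∀ u, G u ⬝ᵥ G u ≤ F u ⬝ᵥ F u) :
    ∃ M : Matrix ι ι ℝ, ‖Matrix.toEuclideanCLM (𝕜 := ℝ) M‖ ≤ 1 ∧
      ∀ u, M.mulVec (F u) = G u := by
  let L := (WithLp.linearEquiv 2 ℝ (ι → ℝ)).symm
  let F' : X →ₗ[ℝ] EuclideanSpace ℝ ι := L.toLinearMap ∘ₗ F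
  let G' : X →ₗ[ℝ] EuclideanSpace ℝ ι := L.toLinearMap ∘ₗ G
  have hn : ∀ u, ‖G' u‖ ≤ ‖F' u‖ := fun u => by
    rw [← sq_le_sq₀ (norm_nonneg _) (norm_nonneg _)]
    exact (norm_toLp_sq (G u)).trans_le ((hFG u).trans_eq (norm_toLp_sq (F u)).symm)
  -- With a linear section `s` of `F`, the operator `G ∘ s` on the range of `F` is a contraction; it
  -- is continued by zero on the orthogonal complement.
  obtain ⟨s, hs⟩ := F'.rangeRestrict.exists_rightInverse_of_surjective F'.range_rangeRestrict
  have hs' : ∀ r : LinearMap.range F', F' (s r) = r := fun r =>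
    congrArg Subtype.val (LinearMap.congr_fun hs r)
  let g : LinearMap.range F' →L[ℝ] EuclideanSpace ℝ ι := (G' ∘ₗ s).mkContinuous 1 fun r => by
    rw [one_mul]
    exact (hn (s r)).trans_eq (by rw [hs']; rfl)
  have hg : ‖g‖ ≤ 1 := LinearMap.mkContinuous_norm_le _ zero_le_one _
  have hgF : ∀ u (hu : F' u ∈ LinearMap.range F'), g ⟨F' u, hu⟩ = G' u := fun u hu => by
    have h1 : F' (s ⟨F' u, hu⟩ - u) = 0 := by rw [map_sub, hs', sub_self]
    have h2 := hn (s ⟨F' u, hu⟩ - u)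
    rw [h1, norm_zero, norm_le_zero_iff, map_sub, sub_eq_zero] at h2
    exact h2
  let T : EuclideanSpace ℝ ι →L[ℝ] EuclideanSpace ℝ ι :=
    g ∘L (LinearMap.range F').orthogonalProjectionOnto
  have hT : Matrix.toEuclideanCLM (𝕜 := ℝ) ((Matrix.toEuclideanCLM (𝕜 := ℝ)).symm T) = T :=
    (Matrix.toEuclideanCLM (𝕜 := ℝ)).apply_symm_apply T
  refine ⟨(Matrix.toEuclideanCLM (𝕜 := ℝ)).symm T, ?_, fun u => ?_⟩
  · rw [hT]
    refine (ContinuousLinearMap.opNorm_comp_le _ _).trans ?_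
    exact mul_le_one₀ hg (norm_nonneg (LinearMap.range F').orthogonalProjectionOnto)
      (Submodule.orthogonalProjectionOnto_norm_le _)
  · have h1 : T (F' u) = G' u := by
      show g ((LinearMap.range F').orthogonalProjectionOnto (F' u)) = G' u
      rw [← hgF u ⟨u, rfl⟩]
      congr 1
      exact Submodule.orthogonalProjectionOnto_mem_subspace_eq_self
        (⟨F' u, LinearMap.mem_range_self F' u⟩ : LinearMap.range F')
    rw [← hT] at h1
    exact congrArg WithLp.ofLp h1

end DecEq

end Matrices

/-! ### Boundary conditions -/

theorem det_Q_ne_zero {P : Fin (n + 1) → Matrix (Fin d) (Fin d) ℝ}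
    (hPn : (P (Fin.last n)).det ≠ 0) : (Q P).det ≠ 0 := by
  intro h0
  obtain ⟨v, hv0, hv⟩ := Matrix.exists_mulVec_eq_zero_iff.2 h0
  -- The blocks `P_n` on the antidiagonal determine the components of `v` one after the other.
  have key : ∀ j (hj : j < n) (α : Fin d), v (⟨j, hj⟩, α) = 0 := by
    intro j
    induction j using Nat.strong_induction_on with
    | _ j ih =>
      intro hj
      have hvj : (P (Fin.last n)).mulVec (fun α => v (⟨j, hj⟩, α)) = 0 := by
        funext α
        have h1 := congrFun hv (⟨n - 1 - j, by omega⟩, α)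
        rw [Matrix.mulVec, dotProduct, Fintype.sum_prod_type,
          Finset.sum_eq_single (⟨j, hj⟩ : Fin n)] at h1
        · have e : n - 1 - j + j + 1 = n := by omega
          have e2 : extend P n = P (Fin.last n) := dif_pos (Nat.lt_succ_self n)
          simp only [Q_apply, e, e2, Pi.zero_apply, mul_assoc, ← Finset.mul_sum] at h1
          exact (mul_eq_zero.1 h1).resolve_left (pow_ne_zero _ (by norm_num))
        · intro q _ hq
          refine Finset.sum_eq_zero fun β _ => ?_
          rcases lt_or_ge (q : ℕ) j with hlt | hge
          · rw [ih q hlt q.2 β, mul_zero]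
          · have hne : (q : ℕ) ≠ j := fun h => hq (Fin.ext h)
            rw [Q_apply, extend, dif_neg (by simp only; omega), Matrix.zero_apply, mul_zero,
              zero_mul]
        · simp
      exact congrFun (Matrix.eq_zero_of_mulVec_eq_zero hPn hvj)
  exact hv0 (funext fun p => key p.1 p.1.2 p.2)

section Boundary

variable (P : Fin (n + 1) → Matrix (Fin d) (Fin d) ℝ) {𝓗 : ℝ → Matrix (Fin d) (Fin d) ℝ}
  (h𝓗 : ∀ i j, MemLp (fun x => 𝓗 x i j) ∞ (μ a b))

/-- The trace of `𝓗 u` at `t`, as a linear map in `u ∈ dom(A)`. -/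
def weightedTrace (hab : a < b) {t : ℝ} (ht : t ∈ Icc a b) :
    (portHamiltonian P 𝓗 h𝓗).domain →ₗ[ℝ] (Fin n × Fin d → ℝ) :=
  traceₗ hab ht ∘ₗ (mulL2 𝓗 h𝓗).restrict (fun _ hu => hu)

/-- The boundary value `Q₊ tr_b 𝓗 u + Q₋ tr_a 𝓗 u`. -/
def boundaryPlus (hab : a < b) : (portHamiltonian P 𝓗 h𝓗).domain →ₗ[ℝ] (Fin n × Fin d → ℝ) :=
  (Qplus P).mulVecLin ∘ₗ weightedTrace P h𝓗 hab (right_mem_Icc.2 hab.le)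
    + (Qminus P).mulVecLin ∘ₗ weightedTrace P h𝓗 hab (left_mem_Icc.2 hab.le)

/-- The boundary value `Q₋ tr_b 𝓗 u + Q₊ tr_a 𝓗 u`. -/
def boundaryMinus (hab : a < b) : (portHamiltonian P 𝓗 h𝓗).domain →ₗ[ℝ] (Fin n × Fin d → ℝ) :=
  (Qminus P).mulVecLin ∘ₗ weightedTrace P h𝓗 hab (right_mem_Icc.2 hab.le)
    + (Qplus P).mulVecLin ∘ₗ weightedTrace P h𝓗 hab (left_mem_Icc.2 hab.le)

variable {P}

theorem two_mul_weightedInner_eq_boundary (hab : a < b)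
    (hP : ∀ j : Fin (n + 1), (P j).transpose = (-1 : ℝ) ^ ((j : ℕ) + 1) • P j)
    (hsymm : ∀ᵐ x ∂(μ a b), (𝓗 x).IsSymm) (u : (portHamiltonian P 𝓗 h𝓗).domain) :
    2 * weightedInner 𝓗 (portHamiltonian P 𝓗 h𝓗 u) u
      = boundaryPlus P h𝓗 hab u ⬝ᵥ boundaryPlus P h𝓗 hab u
        - boundaryMinus P h𝓗 hab u ⬝ᵥ boundaryMinus P h𝓗 hab u := by
  rw [two_mul_weightedInner_portHamiltonian h𝓗 hab hP hsymm u]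
  exact ((isRootPair_cfc (Q_isHermitian hP)).dotProduct_sub_dotProduct _ _).symm

/-- `1 + A` is injective on the subspace given by a contraction `M`, where `A` is accretive. -/
theorem eq_zero_of_add_portHamiltonian_eq_zero (hab : a < b)
    (hP : ∀ j : Fin (n + 1), (P j).transpose = (-1 : ℝ) ^ ((j : ℕ) + 1) • P j)
    (hsymm : ∀ᵐ x ∂(μ a b), (𝓗 x).IsSymm)
    {c : ℝ} (hc0 : 0 < c) (hc : ∀ᵐ x ∂(μ a b), ∀ v : EuclideanSpace ℝ (Fin d),
      c * ‖v‖ ^ 2 ≤ inner ℝ (Matrix.toEuclideanLin (𝓗 x) v) v)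
    {M : Matrix (Fin n × Fin d) (Fin n × Fin d) ℝ} (hM : ‖Matrix.toEuclideanCLM (𝕜 := ℝ) M‖ ≤ 1)
    {u : (portHamiltonian P 𝓗 h𝓗).domain}
    (hu : M.mulVec (boundaryPlus P h𝓗 hab u) = boundaryMinus P h𝓗 hab u)
    (h0 : (u : L2 a b d) + portHamiltonian P 𝓗 h𝓗 u = 0) : u = 0 := by
  have h1 := two_mul_weightedInner_eq_boundary h𝓗 hab hP hsymm u
  have h2 := (norm_toEuclideanCLM_le_one_iff M).1 hM (boundaryPlus P h𝓗 hab u)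
  rw [hu] at h2
  rw [eq_neg_of_add_eq_zero_right h0, weightedInner_eq h𝓗, map_neg, inner_neg_left] at h1
  have h3 := le_inner_mulL2 h𝓗 hc (u : L2 a b d)
  have h4 : ‖(u : L2 a b d)‖ ^ 2 ≤ 0 := by
    by_contra h
    have := mul_pos hc0 (not_le.1 h)
    linarith
  exact Subtype.ext (norm_eq_zero.1 (pow_eq_zero_iff two_ne_zero |>.1
    (le_antisymm h4 (sq_nonneg _))))

/-- The equation `u + A u = f` is solvable under the boundary condition given by a contraction. -/
theorem exists_add_eq_boundary (hab : a < b)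
    (hP : ∀ j : Fin (n + 1), (P j).transpose = (-1 : ℝ) ^ ((j : ℕ) + 1) • P j)
    (hPn : (P (Fin.last n)).det ≠ 0) (hsymm : ∀ᵐ x ∂(μ a b), (𝓗 x).IsSymm)
    {c : ℝ} (hc0 : 0 < c) (hc : ∀ᵐ x ∂(μ a b), ∀ v : EuclideanSpace ℝ (Fin d),
      c * ‖v‖ ^ 2 ≤ inner ℝ (Matrix.toEuclideanLin (𝓗 x) v) v)
    {M : Matrix (Fin n × Fin d) (Fin n × Fin d) ℝ} (hM : ‖Matrix.toEuclideanCLM (𝕜 := ℝ) M‖ ≤ 1)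
    (f : L2 a b d) :
    ∃ u : (portHamiltonian P 𝓗 h𝓗).domain, (u : L2 a b d) + portHamiltonian P 𝓗 h𝓗 u = f ∧
      M.mulVec (boundaryPlus P h𝓗 hab u) = boundaryMinus P h𝓗 hab u := by
  let D := (portHamiltonian P 𝓗 h𝓗).domain
  let N : Submodule ℝ D := LinearMap.ker (D.subtype + (portHamiltonian P 𝓗 h𝓗).toFun)
  have hN : ∀ u : D, u ∈ N ↔ (u : L2 a b d) + portHamiltonian P 𝓗 h𝓗 u = 0 := fun u => Iff.rfl
  let L : D →ₗ[ℝ] (Fin n × Fin d → ℝ) :=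
    M.mulVecLin ∘ₗ boundaryPlus P h𝓗 hab - boundaryMinus P h𝓗 hab
  have hL : ∀ u, L u = M.mulVec (boundaryPlus P h𝓗 hab u) - boundaryMinus P h𝓗 hab u :=
    fun u => rfl
  have hinj : Function.Injective (L ∘ₗ N.subtype) := by
    rw [← LinearMap.ker_eq_bot, LinearMap.ker_eq_bot']
    intro k hk
    refine Subtype.ext (eq_zero_of_add_portHamiltonian_eq_zero h𝓗 hab hP hsymm hc0 hc hM
      (sub_eq_zero.1 ((hL k).symm.trans hk)) ((hN _).1 k.2))
  have : Module.Finite ℝ N := Module.Finite.of_injective _ hinj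
  have hsurj : Function.Surjective
      (weightedTrace P h𝓗 hab (left_mem_Icc.2 hab.le) ∘ₗ N.subtype) := fun η => by
    obtain ⟨k, hk, hkη⟩ := exists_add_portHamiltonian_eq h𝓗 hab hP hPn hsymm hc0 hc 0 η
    exact ⟨⟨k, (hN k).2 hk⟩, hkη⟩
  -- `ker (1 + A)` has the dimension of the space of boundary conditions.
  have hrank : Module.finrank ℝ N = Module.finrank ℝ (Fin n × Fin d → ℝ) :=
    le_antisymm (LinearMap.finrank_le_finrank_of_injective hinj)
      (LinearMap.finrank_le_finrank_of_surjective hsurj)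
  have hLsurj := (LinearMap.injective_iff_surjective_of_finrank_eq_finrank hrank).1 hinj
  obtain ⟨u, hu, -⟩ := exists_add_portHamiltonian_eq h𝓗 hab hP hPn hsymm hc0 hc f 0
  obtain ⟨k, hk⟩ := hLsurj (-L u)
  have hk' : L k = -L u := hk
  refine ⟨u + k, ?_, ?_⟩
  · rw [LinearPMap.map_add, Submodule.coe_add, add_add_add_comm, hu, (hN _).1 k.2, add_zero]
  · rw [← sub_eq_zero, ← hL, map_add, hk', add_neg_cancel]

end Boundary

end PortHamiltonian

end

open PortHamiltonian in
theorem proposition4p11 (a b : ℝ) (hab : a < b) (d n : ℕ)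
    (P : Fin (n + 1) → Matrix (Fin d) (Fin d) ℝ)
    (hP : ∀ j : Fin (n + 1), (P j).transpose = (-1 : ℝ) ^ ((j : ℕ) + 1) • P j)
    (hPn : (P (Fin.last n)).det ≠ 0)
    (𝓗 : ℝ → Matrix (Fin d) (Fin d) ℝ)
    (h𝓗 : ∀ i j, MemLp (fun x => 𝓗 x i j) ∞ (volume.restrict (Ioo a b)))
    (h𝓗symm : ∀ᵐ x ∂(volume.restrict (Ioo a b)), (𝓗 x).IsSymm)
    (h𝓗pos : ∃ c : ℝ, 0 < c ∧ ∀ᵐ x ∂(volume.restrict (Ioo a b)),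
      ∀ v : EuclideanSpace ℝ (Fin d),
        c * ‖v‖ ^ 2 ≤ inner ℝ (Matrix.toEuclideanLin (𝓗 x) v) v)
    (B : L2 a b d →ₗ.[ℝ] L2 a b d) (hB : B ≤ portHamiltonian P 𝓗 h𝓗) :
    List.TFAE [
      IsMAccretive (weightedInner 𝓗) B,
      ∃ M : Matrix (Fin n × Fin d) (Fin n × Fin d) ℝ,
        ‖Matrix.toEuclideanCLM (𝕜 := ℝ) M‖ ≤ 1 ∧
        (B.domain : Set (L2 a b d)) =
          {u | ∃ hu : u ∈ (portHamiltonian P 𝓗 h𝓗).domain,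
            M.mulVec ((Qplus P).mulVec (trace b ⟨mulL2 𝓗 h𝓗 u, hu⟩) +
                (Qminus P).mulVec (trace a ⟨mulL2 𝓗 h𝓗 u, hu⟩)) =
              (Qminus P).mulVec (trace b ⟨mulL2 𝓗 h𝓗 u, hu⟩) +
                (Qplus P).mulVec (trace a ⟨mulL2 𝓗 h𝓗 u, hu⟩)},
      ∃ W : Matrix (Fin n × Fin d) ((Fin n × Fin d) ⊕ (Fin n × Fin d)) ℝ,
        W.rank = n * d ∧
        (W * (blockR P)⁻¹ * blockSwap d n * (W * (blockR P)⁻¹).transpose).PosSemidef ∧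
        (B.domain : Set (L2 a b d)) =
          {u | ∃ hu : u ∈ (portHamiltonian P 𝓗 h𝓗).domain,
            W.mulVec (Sum.elim (trace b ⟨mulL2 𝓗 h𝓗 u, hu⟩)
              (trace a ⟨mulL2 𝓗 h𝓗 u, hu⟩)) = 0}] := by
  obtain ⟨c, hc0, hc⟩ := h𝓗pos
  have hBA : ∀ u : B.domain, B u = portHamiltonian P 𝓗 h𝓗 (Submodule.inclusion hB.1 u) :=
    fun u => hB.2 rfl
  have hroot := isRootPair_cfc (Q_isHermitian hP)
  have hQt : (Q P).transpose = Q P := by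
    rw [← Matrix.conjTranspose_eq_transpose_of_trivial]
    exact Q_isHermitian hP
  have hdet := det_Q_ne_zero hPn
  have hcard : Fintype.card (Fin n × Fin d) = n * d := by simp
  tfae_have 1 → 2 := by
    rintro ⟨hacc, honto⟩
    obtain ⟨M, hM, hMB⟩ := exists_contraction_mulVec_eq
      (boundaryPlus P h𝓗 hab ∘ₗ Submodule.inclusion hB.1)
      (boundaryMinus P h𝓗 hab ∘ₗ Submodule.inclusion hB.1) (fun u => by
        have h1 := hacc u 0
        rw [LinearPMap.map_zero, sub_zero, Submodule.coe_zero, sub_zero, hBA] at h1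
        have h2 := two_mul_weightedInner_eq_boundary h𝓗 hab hP h𝓗symm
          (Submodule.inclusion hB.1 u)
        rw [Submodule.coe_inclusion] at h2
        have h3 := mul_nonneg zero_le_two h1
        rw [h2, sub_nonneg] at h3
        exact h3)
    refine ⟨M, hM, Set.ext fun u => ⟨fun hu => ⟨hB.1 hu, hMB ⟨u, hu⟩⟩, ?_⟩⟩
    rintro ⟨hu, hMu⟩
    -- The restriction of `A` to the right-hand side is still accretive, so `1 +` it is injective,
    -- while the restriction `1 + B` is already onto.
    obtain ⟨v, hv⟩ := honto (u + portHamiltonian P 𝓗 h𝓗 ⟨u, hu⟩)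
    have h0 : (⟨u, hu⟩ - Submodule.inclusion hB.1 v : (portHamiltonian P 𝓗 h𝓗).domain) = 0 := by
      refine eq_zero_of_add_portHamiltonian_eq_zero h𝓗 hab hP h𝓗symm hc0 hc hM ?_ ?_
      · have h1 : M.mulVec (boundaryPlus P h𝓗 hab ⟨u, hu⟩) = boundaryMinus P h𝓗 hab ⟨u, hu⟩ := hMu
        have h2 : M.mulVec (boundaryPlus P h𝓗 hab (Submodule.inclusion hB.1 v))
          = boundaryMinus P h𝓗 hab (Submodule.inclusion hB.1 v) := hMB v
        rw [map_sub, map_sub, Matrix.mulVec_sub, h1, h2]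
      · rw [LinearPMap.map_sub, ← hBA, Submodule.coe_sub, Submodule.coe_inclusion,
          sub_add_sub_comm, hv, sub_self]
    have huv : u = v := congrArg Subtype.val (sub_eq_zero.1 h0)
    rw [huv]
    exact v.2
  tfae_have 2 → 1 := by
    rintro ⟨M, hM, hdom⟩
    have hmem : ∀ u : B.domain, M.mulVec (boundaryPlus P h𝓗 hab (Submodule.inclusion hB.1 u))
        = boundaryMinus P h𝓗 hab (Submodule.inclusion hB.1 u) := fun u => by
      have h1 : (u : L2 a b d) ∈ (B.domain : Set (L2 a b d)) := u.2
      rw [hdom] at h1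
      exact h1.2
    refine ⟨fun u v => ?_, fun f => ?_⟩
    · rw [← LinearPMap.map_sub, ← Submodule.coe_sub, hBA]
      have h1 := two_mul_weightedInner_eq_boundary h𝓗 hab hP h𝓗symm
        (Submodule.inclusion hB.1 (u - v))
      have h2 := (norm_toEuclideanCLM_le_one_iff M).1 hM
        (boundaryPlus P h𝓗 hab (Submodule.inclusion hB.1 (u - v)))
      rw [hmem] at h2
      rw [Submodule.coe_inclusion] at h1
      linarith
    · obtain ⟨u, hu, hMu⟩ := exists_add_eq_boundary h𝓗 hab hP hPn h𝓗symm hc0 hc hM f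
      have huB : (u : L2 a b d) ∈ B.domain := by
        rw [← SetLike.mem_coe, hdom]
        exact ⟨u.2, hMu⟩
      exact ⟨⟨u, huB⟩, by rw [hBA]; exact hu⟩
  tfae_have 2 → 3 := by
    rintro ⟨M, hM, hdom⟩
    obtain ⟨W, hr, hW, hker⟩ := hroot.exists_kernel_of_contraction hQt hdet hM
    refine ⟨W, hr.trans hcard, hW, hdom.trans (Set.ext fun u => exists_congr fun hu => ?_)⟩
    exact (hker _ _).symm
  tfae_have 3 → 2 := by
    rintro ⟨W, hr, hW, hdom⟩
    obtain ⟨M, hM, hker⟩ := hroot.exists_contraction_of_kernel hQt hdet (hr.trans hcard.symm) hW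
    refine ⟨M, hM, hdom.trans (Set.ext fun u => exists_congr fun hu => ?_)⟩
    exact (hker _ _).symm
  tfae_finish
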